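/- \textbf{Definitions.} Fix a ranked alphabet $\Sigma$ of terminals. A \emph{hypergraph} $g$ over a ranked alphabet has a node set $V=\{1,\dots,n\}$ with $n\ge 1$, a finite set $E$ of labelled edges, each edge $e$ attached to a nonempty string $\mathrm{att}(e)$ of pairwise distinct nodes whose length $\mathrm{rank}(e)$ is the rank of the label of $e$, and a string $\mathrm{ext}(g)$ of pairwise distinct external nodes; $\mathrm{rank}(g)=|\mathrm{ext}(g)|$. Its size is $|g|=|V|+|\{e\in E:\mathrm{rank}(e)\le 2\}|+\sum_{e\in E,\ \mathrm{rank}(e)>2}\mathrm{rank}(e)$. Two hypergraphs are isomorphic if a bijection between their node sets carries the edges (with labels, attachments and multiplicities) and the string of external nodes of one to those of the other. An \emph{SL-HR grammar} $G=(N,P,S)$ over $\Sigma$ consists of a finite set $N\subset\mathbb N$ of ranked nonterminals (disjoint from $\Sigma$), exactly one rule $A\to\mathrm{rhs}(A)$ for every $A\in N$, where $\mathrm{rhs}(A)$ is a hypergraph over $\Sigma\cup N$ with $\mathrm{rank}(\mathrm{rhs}(A))=\mathrm{rank}(A)$, and a start graph $S$, a hypergraph over $\Sigma\cup N$, such that the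 relation "$B$ labels an edge of $\mathrm{rhs}(A)$" on $N$ is acyclic and every nonterminal is reachable from $S$. The size of $G$ is $|G|=|S|+\sum_{A\in N}|\mathrm{rhs}(A)|$. A nonterminal edge $e$ labelled $A$ is replaced by deleting $e$, adding a copy of $\mathrm{rhs}(A)$, and identifying the $i$-th external node of the copy with the $i$-th node of $\mathrm{att}(e)$; if the current graph has $n$ nodes, the $i$-th internal (i.e. non-external) node of $\mathrm{rhs}(A)$ becomes the new node $n+i$. The hypergraph $\mathrm{val}(G)$ over $\Sigma$ is obtained from $S$ by replacing all nonterminal edges in this way, in pre-order of the derivation tree, where the nonterminal edges of one right-hand side are ordered lexicographically by attachment and then by label. For a nonempty string $w=a_1\cdots a_k$ of symbols of rank $2$, the hypergraph of $w$ has nodes $1,\dots,k+1$, for each $i$ one edge labelled $a_i$ and attached to $i\cdot(i+1)$, and external nodes $1\cdot(k+1)$. A \emph{string-graph} is a hypergraph isomorphic to the hypergraph of some nonempty string. The grammar $G$ is \emph{string-generating} if $\mathrm{val}(G)$ is a string-graph. \textbf{Corollary.} Let $G=(N,P,S)$ be a string-generating SL-HR grammar over $\Sigma$. Then there is an SL-HR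 grammar $G'=(N',P',S')$ over $\Sigma$ such that \begin{enumerate} \item $\mathrm{val}(G')$ is isomorphic to $\mathrm{val}(G)$, \item $|G'|\le 2|G|$, and \item $S'$ and $\mathrm{rhs}_{G'}(A)$ for every $A\in N'$ are string-graphs. \end{enumerate} -/

import Mathlib

noncomputable section

/-- A hyperedge: a label and the string of nodes it is attached to. -/
structure HEdge (L : Type*) where
  lab : L
  att : List ℕ

/-- The rank of an edge is the number of nodes it is attached to. -/
def HEdge.rank {L : Type*} (e : HEdge L) : ℕ := e.att.length

/-- Renaming of the attachment nodes of an edge. -/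
def HEdge.rename {L : Type*} (ρ : ℕ → ℕ) (e : HEdge L) : HEdge L := ⟨e.lab, e.att.map ρ⟩

/-- The data of a hypergraph with node set `{1, …, n}`, a finite family of labelled edges, and a
string of external nodes.  The family of edges is recorded as a multiset, so that parallel edges
with the same label are allowed and edges have no identity apart from label and attachment.
The validity conditions are in `HGraph.Valid`. -/
structure HGraph (L : Type*) where
  n : ℕ
  edges : Multiset (HEdge L)
  ext : List ℕ

namespace HGraph

variable {L T : Type*}

/-- `g` is a hypergraph over the ranked alphabet `(L, rk)`: at least one node; every edge is
attached to at least one node, to as many nodes as the rank of its label, and to no node twice;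
no node is external twice. -/
structure Valid (rk : L → ℕ) (g : HGraph L) : Prop where
  one_le_n : 1 ≤ g.n
  att_mem : ∀ e ∈ g.edges, ∀ v ∈ e.att, v ∈ Finset.Icc 1 g.n
  att_ne_nil : ∀ e ∈ g.edges, e.att ≠ []
  rank_lab : ∀ e ∈ g.edges, e.rank = rk e.lab
  att_nodup : ∀ e ∈ g.edges, e.att.Nodup
  ext_mem : ∀ v ∈ g.ext, v ∈ Finset.Icc 1 g.n
  ext_nodup : g.ext.Nodup

/-- The rank of a hypergraph. -/
def rank (g : HGraph L) : ℕ := g.ext.length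

/-- Edge size: edges of rank at most two count one, other edges count their rank. -/
def edgeSize (g : HGraph L) : ℕ :=
  (g.edges.map fun e => if e.rank ≤ 2 then 1 else e.rank).sum

/-- Size: number of nodes plus edge size. -/
def size (g : HGraph L) : ℕ := g.n + g.edgeSize

/-- Two hypergraphs are isomorphic if a bijection between the node sets carries the edges
(with labels and attachment) and the string of external nodes of one to those of the other. -/
def Iso (g h : HGraph L) : Prop :=
  ∃ σ : ℕ → ℕ, Set.BijOn σ (Set.Icc 1 g.n) (Set.Icc 1 h.n) ∧
    g.edges.map (HEdge.rename σ) = h.edges ∧ g.ext.map σ = h.ext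

/-- The hypergraph of a string `a₁⋯aₖ`: nodes `1, …, k+1`, for each `i` an `aᵢ`-labelled edge from
`i` to `i+1`, and external nodes `1` and `k+1`. -/
def sGraph (w : List L) : HGraph L where
  n := w.length + 1
  edges := (List.ofFn fun i : Fin w.length => (⟨w.get i, [(i : ℕ) + 1, (i : ℕ) + 2]⟩ : HEdge L))
  ext := [1, w.length + 1]

/-- String-graphs, up to isomorphism.  (For the empty string the two external nodes would coincide,
which is not allowed in a hypergraph.) -/
def IsStringGraph (g : HGraph L) : Prop :=
  ∃ w : List L, w ≠ [] ∧ g.Iso (sGraph w)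

/-- The internal (non-external) nodes. -/
def internal (g : HGraph L) : Finset ℕ := (Finset.Icc 1 g.n).filter (· ∉ g.ext)

/-- The renaming of the nodes of `h` used when `h` replaces an edge attached to `att` in a graph
with `n` nodes: the `i`-th external node goes to the `i`-th node of `att`, and the `i`-th internal
node (in increasing order) goes to the new node `n + i`. -/
def nodeMap (h : HGraph L) (n : ℕ) (att : List ℕ) (v : ℕ) : ℕ :=
  if v ∈ h.ext then att.getD (h.ext.idxOf v) 0
  else n + (h.internal.filter (· ≤ v)).card

open Classical in
/-- Replacement of the edge `e` by `h` in `g`. -/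
def replace (g : HGraph L) (e : HEdge L) (h : HGraph L) : HGraph L where
  n := g.n + h.internal.card
  edges := g.edges.erase e + h.edges.map (HEdge.rename (h.nodeMap g.n e.att))
  ext := g.ext

/-- The nonterminal edges of `g`, as pairs (attachment, nonterminal), sorted by attachment
(lexicographically) and then by label. Terminals are the labels `inl a`, nonterminals are the labels
`inr A`. -/
def siblings (g : HGraph (T ⊕ ℕ)) : List (List ℕ ×ₗ ℕ) :=
  (g.edges.filterMap fun e =>
    match e.lab with
    | Sum.inl _ => none
    | Sum.inr A => some (toLex (e.att, A))).sort (· ≤ ·)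

end HGraph

/-- A straight-line hyperedge replacement grammar over the ranked alphabet `(T, rk)`.  Labels are
terminals `inl a` with `a : T` or nonterminals `inr A` with `A ∈ N`, so that the two alphabets are
disjoint.  For each nonterminal there is exactly one rule, with right-hand side `rhs A`
(the values of `rhs` and `ntRank` outside `N` play no role). -/
structure SLHRGrammar {T : Type*} (rk : T → ℕ) where
  N : Finset ℕ
  ntRank : ℕ → ℕ
  rhs : ℕ → HGraph (T ⊕ ℕ)
  start : HGraph (T ⊕ ℕ)
  rhs_valid : ∀ A ∈ N, (rhs A).Valid (Sum.elim rk ntRank)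
  start_valid : start.Valid (Sum.elim rk ntRank)
  rhs_rank : ∀ A ∈ N, (rhs A).rank = ntRank A
  rhs_closed : ∀ A ∈ N, ∀ e ∈ (rhs A).edges, ∀ B, e.lab = Sum.inr B → B ∈ N
  start_closed : ∀ e ∈ start.edges, ∀ B, e.lab = Sum.inr B → B ∈ N
  /-- The relation "`B` labels an edge of the right-hand side of `A`" is acyclic. -/
  acyclic : ∀ A, ¬ Relation.TransGen
    (fun A B => A ∈ N ∧ ∃ e ∈ (rhs A).edges, e.lab = Sum.inr B) A A
  /-- There are no useless (unreachable) nonterminals. -/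
  reachable : ∀ A ∈ N, ∃ e ∈ start.edges, ∃ B, e.lab = Sum.inr B ∧ Relation.ReflTransGen
    (fun A B => A ∈ N ∧ ∃ e ∈ (rhs A).edges, e.lab = Sum.inr B) B A

namespace SLHRGrammar

variable {T : Type*} {rk : T → ℕ}

/-- `G.Uses A B`: the nonterminal `B` occurs in the right-hand side of the nonterminal `A`. -/
def Uses (G : SLHRGrammar rk) (A B : ℕ) : Prop :=
  A ∈ G.N ∧ ∃ e ∈ (G.rhs A).edges, e.lab = Sum.inr B

theorem wellFounded_uses (G : SLHRGrammar rk) : WellFounded (fun B A => G.Uses A B) := by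
  have hirr : ∀ A, ¬ Relation.TransGen (fun B A => G.Uses A B) A A := by
    intro A h
    have h2 := (Relation.transGen_swap (r := G.Uses)).1 h
    exact G.acyclic A h2
  let r : ℕ → ℕ → Prop := Relation.TransGen (fun B A => G.Uses A B)
  have : IsStrictOrder ℕ r := { irrefl := hirr, trans := fun _ _ _ h h' => h.trans h' }
  have hN : (G.N : Set ℕ).WellFoundedOn r := G.N.wellFoundedOn
  rw [Set.wellFoundedOn_iff] at hN
  have key : ∀ A, A ∈ G.N → Acc (fun B A => G.Uses A B) A := by
    intro A
    induction A using hN.induction with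
    | _ A ih =>
      intro hA
      refine Acc.intro _ fun B hB => ?_
      obtain ⟨_, e, he, hl⟩ := id hB
      have hBN := G.rhs_closed A hA e he B hl
      exact ih B ⟨Relation.TransGen.single hB, hBN, hA⟩ hBN
  refine ⟨fun A => ?_⟩
  by_cases hA : A ∈ G.N
  · exact key A hA
  · exact Acc.intro _ fun B hB => absurd hB.1 hA

theorem uses_of_mem_siblings (G : SLHRGrammar rk) {A : ℕ} (hA : A ∈ G.N) {c : List ℕ ×ₗ ℕ}
    (hc : c ∈ (G.rhs A).siblings) : G.Uses A (ofLex c).2 := by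
  simp only [HGraph.siblings, Multiset.mem_sort, Multiset.mem_filterMap] at hc
  obtain ⟨e, he, h⟩ := hc
  refine ⟨hA, e, he, ?_⟩
  cases hl : e.lab with
  | inl a => simp [hl] at h
  | inr B => simp only [hl, Option.some.injEq] at h; subst h; rfl

/-- Complete derivation, inside the current graph `g`, of an `A`-labelled edge attached to `att`:
the edge is replaced by the right-hand side of `A`, and then the nonterminal edges that this
introduces are completely derived one after the other, in the order of the siblings of
`rhs A`. -/
def deriveEdge (G : SLHRGrammar rk) (A : ℕ) (att : List ℕ) (g : HGraph (T ⊕ ℕ)) :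
    HGraph (T ⊕ ℕ) :=
  if hA : A ∈ G.N then
    (G.rhs A).siblings.attach.foldl
      (fun g' (c : {c // c ∈ (G.rhs A).siblings}) =>
        have : G.Uses A (ofLex c.1).2 := G.uses_of_mem_siblings hA c.2
        G.deriveEdge (ofLex c.1).2 ((ofLex c.1).1.map ((G.rhs A).nodeMap g.n att)) g')
      (g.replace ⟨Sum.inr A, att⟩ (G.rhs A))
  else g
termination_by G.wellFounded_uses.wrap A

/-- The hypergraph `val(G)`: all nonterminal edges of the start graph are completely derived, in
pre-order of the derivation tree. -/
def val (G : SLHRGrammar rk) : HGraph (T ⊕ ℕ) :=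
  G.start.siblings.foldl (fun g c => G.deriveEdge (ofLex c).2 (ofLex c).1 g) G.start

/-- `G` is string-generating if `val(G)` is a string-graph. -/
def StringGenerating (G : SLHRGrammar rk) : Prop := G.val.IsStringGraph

/-- The size of a grammar: the sum of the sizes of all right-hand sides, start graph included. -/
def size (G : SLHRGrammar rk) : ℕ := G.start.size + ∑ A ∈ G.N, (G.rhs A).size

end SLHRGrammar

end

/-!
Everything derived from a nonterminal `A` of a string-generating grammar sits inside a string-graph,
so it is a disjoint union of directed paths.  The internal nodes of the derived hypergraph are
incident with no edges from elsewhere; hence each of them has an outgoing edge inside it, and a path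
can leave or end only at external nodes of `A` (`Linear`, `linear_of_embedded_start`).  Cutting the
paths at the external nodes splits the hypergraph into *segments*: for each external node `i` at
which an edge starts, the walk from `i` to the next external node.  Which segments exist and which
words they spell depends on `A` alone, because two derivations of `A` differ by a renaming of nodes
only (`yield_map`).

The new grammar has the pairs `(A, i)` as nonterminals.  Inside the right-hand side of `A`, a
segment is cut at the nodes of that right-hand side.  Each piece is either a terminal edge, or a
segment of a nonterminal edge, since a path can enter and leave what is derived from a nonterminal
edge only through the attachment nodes of the edge (`Embedded.exists_piece`).  The labels of the pieces form
the rule of `(A, i)` (`Embedded.exists_rule`), and the word between the external nodes of the start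
graph gives the new start string in the same way.

For the size, the pieces of all segments of `A` start in different nodes of the right-hand side `h`
of `A`, each incident with an edge, because no node of a string-graph has two incoming edges
(`IWalk.start_unique`).  If there are `d` pieces then the new rules have total size at most `3 * d`,
and `d` is at most the number of nodes of `h` and at most twice the edge size of `h`
(`sum_size_le`).

Finally, a grammar whose right-hand sides are string-graphs generates the string-graph of the word
that it generates as a string grammar (`StringRules.iso_val`): by induction, the edges derived from
a nonterminal form a path through all the new nodes.
-/

/-! ### Complete derivations in closed form -/

namespace HGraph

variable {T : Type*}

/-- The terminal edges of a hypergraph. -/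
def termEdges (h : HGraph (T ⊕ ℕ)) : Multiset (HEdge (T ⊕ ℕ)) :=
  h.edges.filter fun e => e.lab.isLeft

/-- The nonterminal edge recorded by a pair (attachment, nonterminal). -/
def ntEdge (c : List ℕ ×ₗ ℕ) : HEdge (T ⊕ ℕ) := ⟨Sum.inr (ofLex c).2, (ofLex c).1⟩

/-- Renaming of the attachment nodes in a pair (attachment, nonterminal). -/
def mapAtt (ν : ℕ → ℕ) (c : List ℕ ×ₗ ℕ) : List ℕ ×ₗ ℕ :=
  toLex ((ofLex c).1.map ν, (ofLex c).2)

theorem edges_eq_termEdges_add (h : HGraph (T ⊕ ℕ)) :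
    h.edges = h.termEdges + ((h.siblings.map ntEdge : List (HEdge (T ⊕ ℕ))) :
      Multiset (HEdge (T ⊕ ℕ))) := by
  rw [termEdges, siblings, ← Multiset.map_coe, Multiset.sort_eq]
  generalize h.edges = s
  induction s using Multiset.induction_on with
  | empty => simp
  | cons e s ih =>
    obtain ⟨a | A, att⟩ := e
    · rw [Multiset.filter_cons_of_pos _ (by rfl), Multiset.filterMap_cons_none _ _ (by rfl),
        Multiset.cons_add, ← ih]
    · rw [Multiset.filter_cons_of_neg _ (by simp),
        Multiset.filterMap_cons_some _ _ _ (b := toLex (att, A)) (by rfl), Multiset.map_cons,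
        Multiset.add_cons, ← ih]
      rfl

theorem mem_termEdges {h : HGraph (T ⊕ ℕ)} {e : HEdge (T ⊕ ℕ)} :
    e ∈ h.termEdges ↔ e ∈ h.edges ∧ ∃ a, e.lab = Sum.inl a := by
  rw [termEdges, Multiset.mem_filter, Sum.isLeft_iff]

theorem ntEdge_mem {h : HGraph (T ⊕ ℕ)} {c : List ℕ ×ₗ ℕ} (hc : c ∈ h.siblings) :
    (ntEdge c : HEdge (T ⊕ ℕ)) ∈ h.edges := by
  rw [edges_eq_termEdges_add]
  exact Multiset.mem_add.2 (Or.inr (Multiset.mem_coe.2 (List.mem_map_of_mem hc)))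

theorem mem_siblings {h : HGraph (T ⊕ ℕ)} {e : HEdge (T ⊕ ℕ)} {A : ℕ} (he : e ∈ h.edges)
    (hA : e.lab = Sum.inr A) : toLex (e.att, A) ∈ h.siblings := by
  rw [siblings, Multiset.mem_sort, Multiset.mem_filterMap]
  exact ⟨e, he, by simp [hA]⟩

end HGraph

namespace SLHRGrammar

open HGraph

variable {T : Type*} {rk : T → ℕ}

/-- The number of nodes created by the complete derivation of an `A`-labelled edge. -/
noncomputable def newCount (G : SLHRGrammar rk) (A : ℕ) : ℕ :=
  (G.deriveEdge A [] ⟨0, {⟨Sum.inr A, []⟩}, []⟩).n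

/-- The edges created by the complete derivation of an `A`-labelled edge attached to `att` in a
graph with `n` nodes. -/
noncomputable def yield (G : SLHRGrammar rk) (A : ℕ) (att : List ℕ) (n : ℕ) :
    Multiset (HEdge (T ⊕ ℕ)) :=
  (G.deriveEdge A att ⟨n, {⟨Sum.inr A, att⟩}, []⟩).edges

/-- The number of nodes created by deriving a list of nonterminal edges. -/
noncomputable def newCountList (G : SLHRGrammar rk) (l : List (List ℕ ×ₗ ℕ)) : ℕ :=
  (l.map fun c => G.newCount (ofLex c).2).sum

/-- The edges created by deriving a list of nonterminal edges one after the other, starting in a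
graph with `n` nodes. -/
noncomputable def yieldList (G : SLHRGrammar rk) : List (List ℕ ×ₗ ℕ) → ℕ → Multiset (HEdge (T ⊕ ℕ))
  | [], _ => 0
  | c :: l, n => G.yield (ofLex c).2 (ofLex c).1 n + G.yieldList l (n + G.newCount (ofLex c).2)

/-- The edges obtained from a copy of `h`, embedded by `ν` in a graph with `n` nodes, by deriving
all its nonterminal edges. -/
noncomputable def yieldGraph (G : SLHRGrammar rk) (h : HGraph (T ⊕ ℕ)) (ν : ℕ → ℕ) (n : ℕ) :
    Multiset (HEdge (T ⊕ ℕ)) :=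
  h.termEdges.map (HEdge.rename ν) + G.yieldList (h.siblings.map (mapAtt ν)) n

theorem newCountList_map_mapAtt (G : SLHRGrammar rk) (ν : ℕ → ℕ) (l : List (List ℕ ×ₗ ℕ)) :
    G.newCountList (l.map (mapAtt ν)) = G.newCountList l := by
  simp only [newCountList, List.map_map]; rfl

/-- Deriving a list of nonterminal edges one after the other, given that each single derivation
removes its edge and adds new nodes and edges only. -/
theorem foldl_deriveEdge (G : SLHRGrammar rk) (l : List (List ℕ ×ₗ ℕ))
    (hl : ∀ c ∈ l, ∀ (n : ℕ) (E : Multiset (HEdge (T ⊕ ℕ))) (x : List ℕ),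
      G.deriveEdge (ofLex c).2 (ofLex c).1 ⟨n, E + {ntEdge c}, x⟩ =
        ⟨n + G.newCount (ofLex c).2, E + G.yield (ofLex c).2 (ofLex c).1 n, x⟩)
    (n : ℕ) (E : Multiset (HEdge (T ⊕ ℕ))) (x : List ℕ) :
    l.foldl (fun g c => G.deriveEdge (ofLex c).2 (ofLex c).1 g)
        ⟨n, E + ((l.map ntEdge : List (HEdge (T ⊕ ℕ))) : Multiset (HEdge (T ⊕ ℕ))), x⟩ =
      ⟨n + G.newCountList l, E + G.yieldList l n, x⟩ := by
  induction l generalizing n E with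
  | nil => simp [newCountList, yieldList]
  | cons c l ih =>
    have h1 : E + ((((c :: l).map ntEdge : List (HEdge (T ⊕ ℕ)))) : Multiset (HEdge (T ⊕ ℕ))) =
        (E + ((l.map ntEdge : List (HEdge (T ⊕ ℕ))) : Multiset (HEdge (T ⊕ ℕ)))) +
          {ntEdge c} := by
      rw [List.map_cons, ← Multiset.cons_coe, Multiset.add_cons, add_comm _ {_},
        Multiset.singleton_add]
    rw [List.foldl_cons, h1, hl c (by simp), add_right_comm,
      ih (fun c' hc' => hl c' (List.mem_cons_of_mem _ hc'))]
    simp only [newCountList, yieldList, List.map_cons, List.sum_cons, add_assoc]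

/-- The complete derivation of a nonterminal edge does not depend on the rest of the graph, except
through the number of nodes. -/
theorem deriveEdge_eq (G : SLHRGrammar rk) (A : ℕ) (hA : A ∈ G.N) (att : List ℕ) (n : ℕ)
    (E : Multiset (HEdge (T ⊕ ℕ))) (x : List ℕ) :
    G.deriveEdge A att ⟨n, E + {⟨Sum.inr A, att⟩}, x⟩ =
      ⟨n + ((G.rhs A).internal.card + G.newCountList (G.rhs A).siblings),
        E + G.yieldGraph (G.rhs A) ((G.rhs A).nodeMap n att) (n + (G.rhs A).internal.card), x⟩ := by
  induction A using G.wellFounded_uses.induction generalizing att n E x with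
  | _ A ih =>
    rw [deriveEdge, dif_pos hA]
    simp only []
    have hspec : ∀ B, G.Uses A B → ∀ (att : List ℕ) (n : ℕ) (E : Multiset (HEdge (T ⊕ ℕ)))
        (x : List ℕ), G.deriveEdge B att ⟨n, E + {⟨Sum.inr B, att⟩}, x⟩ =
          ⟨n + G.newCount B, E + G.yield B att n, x⟩ := by
      intro B hB att n E x
      have hBN : B ∈ G.N := by
        obtain ⟨_, e, he, hl⟩ := hB
        exact G.rhs_closed A hA e he B hl
      have h0 := fun att n E x => ih B hB hBN att n E x
      have h1 : G.newCount B = (G.rhs B).internal.card + G.newCountList (G.rhs B).siblings := by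
        have := h0 [] 0 0 []
        rw [zero_add] at this
        rw [newCount, this, zero_add]
      have h2 : G.yield B att n =
          G.yieldGraph (G.rhs B) ((G.rhs B).nodeMap n att) (n + (G.rhs B).internal.card) := by
        have := h0 att n 0 []
        rw [zero_add] at this
        rw [yield, this, zero_add]
      rw [h0, h1, h2]
    have hfold := fun f (g : HGraph (T ⊕ ℕ)) => List.foldl_attach (l := (G.rhs A).siblings)
      (f := f) (b := g)
    -- The recursive call is seen as a derivation of the siblings with renamed attachments.
    rw [hfold (fun g' c => G.deriveEdge (ofLex c).2
      ((ofLex c).1.map ((G.rhs A).nodeMap n att)) g')]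
    have hmap := fun g : HGraph (T ⊕ ℕ) => List.foldl_map
      (f := mapAtt ((G.rhs A).nodeMap n att)) (l := (G.rhs A).siblings)
      (g := fun g c => G.deriveEdge (ofLex c).2 (ofLex c).1 g) (init := g)
    refine Eq.trans (hmap _).symm ?_
    have hrep : (⟨n, E + {⟨Sum.inr A, att⟩}, x⟩ : HGraph (T ⊕ ℕ)).replace ⟨Sum.inr A, att⟩
        (G.rhs A) = ⟨n + (G.rhs A).internal.card,
          (E + (G.rhs A).termEdges.map (HEdge.rename ((G.rhs A).nodeMap n att))) +
          ((((G.rhs A).siblings.map (mapAtt ((G.rhs A).nodeMap n att))).map ntEdge :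
            List (HEdge (T ⊕ ℕ))) : Multiset (HEdge (T ⊕ ℕ))), x⟩ := by
      classical
      simp only [replace, HGraph.mk.injEq, true_and, and_true]
      rw [add_comm _ {_}, Multiset.singleton_add, Multiset.erase_cons_head, add_assoc]
      congr 1
      conv_lhs => rw [edges_eq_termEdges_add (G.rhs A)]
      rw [Multiset.map_add, Multiset.map_coe, List.map_map, List.map_map]
      rfl
    rw [hrep, foldl_deriveEdge, newCountList_map_mapAtt]
    · simp only [yieldGraph, add_assoc]
    · intro c hc n' E' x'
      obtain ⟨c', hc', rfl⟩ := List.mem_map.1 hc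
      exact hspec _ (G.uses_of_mem_siblings hA hc') _ _ _ _

theorem newCount_eq (G : SLHRGrammar rk) {A : ℕ} (hA : A ∈ G.N) :
    G.newCount A = (G.rhs A).internal.card + G.newCountList (G.rhs A).siblings := by
  have := G.deriveEdge_eq A hA [] 0 0 []
  rw [zero_add] at this
  rw [newCount, this, zero_add]

theorem yield_eq (G : SLHRGrammar rk) {A : ℕ} (hA : A ∈ G.N) (att : List ℕ) (n : ℕ) :
    G.yield A att n =
      G.yieldGraph (G.rhs A) ((G.rhs A).nodeMap n att) (n + (G.rhs A).internal.card) := by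
  have := G.deriveEdge_eq A hA att n 0 []
  rw [zero_add] at this
  rw [yield, this, zero_add]

theorem mem_N_of_mem_siblings_start (G : SLHRGrammar rk) {c : List ℕ ×ₗ ℕ}
    (hc : c ∈ G.start.siblings) : (ofLex c).2 ∈ G.N :=
  G.start_closed _ (ntEdge_mem hc) _ rfl

/-- The generated hypergraph, in closed form. -/
theorem val_eq (G : SLHRGrammar rk) :
    G.val = ⟨G.start.n + G.newCountList G.start.siblings,
      G.yieldGraph G.start id G.start.n, G.start.ext⟩ := by
  have hid : ∀ l : List (List ℕ ×ₗ ℕ), l.map (mapAtt id) = l := by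
    intro l
    refine (List.map_congr_left fun c _ => ?_).trans (List.map_id l)
    simp [mapAtt]
  have hren : HEdge.rename id = (id : HEdge (T ⊕ ℕ) → _) := by
    funext e; simp [HEdge.rename]
  have h := G.foldl_deriveEdge G.start.siblings (fun c hc n E x => by
    have hN := G.mem_N_of_mem_siblings_start hc
    rw [G.newCount_eq hN, G.yield_eq hN]
    exact G.deriveEdge_eq _ hN _ _ _ _) G.start.n G.start.termEdges G.start.ext
  rw [← edges_eq_termEdges_add] at h
  rw [yieldGraph, hid, hren, Multiset.map_id]
  exact h

end SLHRGrammar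

/-! ### Nodes and renaming of derived edges -/

namespace HGraph

variable {T : Type*}

theorem nodeMap_of_mem_ext {h : HGraph (T ⊕ ℕ)} (n : ℕ) {att : List ℕ} {v : ℕ}
    (hv : v ∈ h.ext) (hlen : att.length = h.rank) :
    ∃ hi : h.ext.idxOf v < att.length, h.nodeMap n att v = att[h.ext.idxOf v] := by
  have hi : h.ext.idxOf v < att.length := by
    rw [hlen]; exact List.idxOf_lt_length_iff.2 hv
  refine ⟨hi, ?_⟩
  rw [nodeMap, if_pos hv, List.getD_eq_getElem _ _ hi]

theorem nodeMap_of_notMem_ext {h : HGraph (T ⊕ ℕ)} {v : ℕ}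
    (hv : v ∉ h.ext) (hv1 : v ∈ Finset.Icc 1 h.n) :
    ∃ i, 1 ≤ i ∧ i ≤ h.internal.card ∧
      ∀ n att, h.nodeMap n att v = n + i := by
  refine ⟨(h.internal.filter (· ≤ v)).card, ?_, Finset.card_filter_le _ _, fun n att => ?_⟩
  · exact Finset.card_pos.2 ⟨v, Finset.mem_filter.2 ⟨Finset.mem_filter.2 ⟨hv1, hv⟩, le_rfl⟩⟩
  · rw [nodeMap, if_neg hv]

theorem nodeMap_strict {h : HGraph (T ⊕ ℕ)} (n : ℕ) (att : List ℕ) {u v : ℕ}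
    (hu : u ∉ h.ext) (hv : v ∉ h.ext) (hv1 : v ∈ Finset.Icc 1 h.n) (huv : u < v) :
    h.nodeMap n att u < h.nodeMap n att v := by
  rw [nodeMap, if_neg hu, nodeMap, if_neg hv]
  refine Nat.add_lt_add_left (Finset.card_lt_card ?_) n
  refine Finset.ssubset_iff_of_subset (fun x hx => ?_) |>.2 ⟨v, ?_, ?_⟩
  · rw [Finset.mem_filter] at hx ⊢
    exact ⟨hx.1, hx.2.trans huv.le⟩
  · exact Finset.mem_filter.2 ⟨Finset.mem_filter.2 ⟨hv1, hv⟩, le_rfl⟩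
  · intro hx
    exact absurd (Finset.mem_filter.1 hx).2 (not_le.2 huv)

/-- An embedding of a right-hand side sends the external nodes to the attachment of the replaced
edge and the internal nodes to new nodes. -/
theorem nodeMap_mem {h : HGraph (T ⊕ ℕ)} {n : ℕ} {att : List ℕ} {v : ℕ}
    (hlen : att.length = h.rank) (hv1 : v ∈ Finset.Icc 1 h.n) :
    (v ∈ h.ext ∧ h.nodeMap n att v ∈ att) ∨
      (v ∉ h.ext ∧ n < h.nodeMap n att v ∧ h.nodeMap n att v ≤ n + h.internal.card) := by
  by_cases hv : v ∈ h.ext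
  · obtain ⟨hi, he⟩ := nodeMap_of_mem_ext n hv hlen
    exact Or.inl ⟨hv, he ▸ List.getElem_mem hi⟩
  · obtain ⟨i, h1, h2, h3⟩ := nodeMap_of_notMem_ext hv hv1
    refine Or.inr ⟨hv, ?_⟩
    rw [h3]; omega

theorem nodeMap_injOn {h : HGraph (T ⊕ ℕ)} {n : ℕ} {att : List ℕ}
    (hlen : att.length = h.rank) (hatt : ∀ v ∈ att, v ≤ n) (hnd : att.Nodup) :
    Set.InjOn (h.nodeMap n att) (Set.Icc 1 h.n) := by
  intro u hu v hv huv
  have hu' : u ∈ Finset.Icc 1 h.n := Finset.mem_Icc.2 hu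
  have hv' : v ∈ Finset.Icc 1 h.n := Finset.mem_Icc.2 hv
  rcases nodeMap_mem (n := n) hlen hu' with ⟨hue, hua⟩ | ⟨hue, hun, -⟩ <;>
    rcases nodeMap_mem (n := n) hlen hv' with ⟨hve, hva⟩ | ⟨hve, hvn, -⟩
  · obtain ⟨hi, hi'⟩ := nodeMap_of_mem_ext n hue hlen
    obtain ⟨hj, hj'⟩ := nodeMap_of_mem_ext n hve hlen
    rw [hi', hj'] at huv
    exact (List.idxOf_inj hue).1 ((hnd.getElem_inj_iff).1 huv)
  · have := hatt _ hua; omega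
  · have := hatt _ hva; omega
  · by_contra hne
    rcases lt_or_gt_of_ne hne with hlt | hlt
    · exact absurd huv (nodeMap_strict n att hue hve hv' hlt).ne
    · exact absurd huv (nodeMap_strict n att hve hue hu' hlt).ne'

/-- Two embeddings of a right-hand side differ by a renaming that is compatible with the
attachments and with the numbering of the new nodes. -/
theorem nodeMap_map {h : HGraph (T ⊕ ℕ)} {n n' : ℕ} {att : List ℕ} {ρ : ℕ → ℕ} {v : ℕ}
    (hlen : att.length = h.rank) (hv1 : v ∈ Finset.Icc 1 h.n)
    (hρ : ∀ i, 1 ≤ i → i ≤ h.internal.card → ρ (n + i) = n' + i) :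
    h.nodeMap n' (att.map ρ) v = ρ (h.nodeMap n att v) := by
  by_cases hv : v ∈ h.ext
  · obtain ⟨hi, he⟩ := nodeMap_of_mem_ext n hv hlen
    obtain ⟨hi', he'⟩ := nodeMap_of_mem_ext n' hv
      (show (att.map ρ).length = h.rank by rw [List.length_map, hlen])
    rw [he, he', List.getElem_map]
  · obtain ⟨i, h1, h2, h3⟩ := nodeMap_of_notMem_ext hv hv1
    rw [h3, h3, hρ i h1 h2]

end HGraph

namespace SLHRGrammar

open HGraph

variable {T : Type*} {rk : T → ℕ}

/-- `h` is a valid hypergraph over the terminals and nonterminals of `G`, as the start graph and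
the right-hand sides are. -/
structure Admissible (G : SLHRGrammar rk) (h : HGraph (T ⊕ ℕ)) : Prop where
  valid : h.Valid (Sum.elim rk G.ntRank)
  closed : ∀ e ∈ h.edges, ∀ B, e.lab = Sum.inr B → B ∈ G.N

theorem admissible_start (G : SLHRGrammar rk) : G.Admissible G.start :=
  ⟨G.start_valid, G.start_closed⟩

theorem admissible_rhs (G : SLHRGrammar rk) {A : ℕ} (hA : A ∈ G.N) : G.Admissible (G.rhs A) :=
  ⟨G.rhs_valid A hA, G.rhs_closed A hA⟩

/-- The list `l` consists of nonterminal edges with attachments of the correct length. -/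
def Ranked (G : SLHRGrammar rk) (l : List (List ℕ ×ₗ ℕ)) : Prop :=
  ∀ c ∈ l, (ofLex c).2 ∈ G.N ∧ (ofLex c).1.length = G.ntRank (ofLex c).2

theorem Admissible.ranked {G : SLHRGrammar rk} {h : HGraph (T ⊕ ℕ)} (hh : G.Admissible h)
    (ν : ℕ → ℕ) : G.Ranked (h.siblings.map (mapAtt ν)) := by
  intro c hc
  obtain ⟨c', hc', rfl⟩ := List.mem_map.1 hc
  refine ⟨hh.closed _ (ntEdge_mem hc') _ rfl, ?_⟩
  have := hh.valid.rank_lab _ (ntEdge_mem hc')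
  simpa [mapAtt, ntEdge, HEdge.rank] using this

theorem Ranked.of_cons {G : SLHRGrammar rk} {c : List ℕ ×ₗ ℕ} {l : List (List ℕ ×ₗ ℕ)}
    (h : G.Ranked (c :: l)) : G.Ranked l := fun c' hc' => h c' (List.mem_cons_of_mem _ hc')

theorem newCountList_cons (G : SLHRGrammar rk) (c : List ℕ ×ₗ ℕ) (l : List (List ℕ ×ₗ ℕ)) :
    G.newCountList (c :: l) = G.newCount (ofLex c).2 + G.newCountList l := by
  simp [newCountList]

/-- All edges in `E` carry terminal labels and are attached to nodes satisfying `P`. -/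
def TermOn (E : Multiset (HEdge (T ⊕ ℕ))) (P : ℕ → Prop) : Prop :=
  ∀ e ∈ E, (∃ a, e.lab = Sum.inl a) ∧ ∀ v ∈ e.att, P v

theorem yieldList_termOn {G : SLHRGrammar rk} {l : List (List ℕ ×ₗ ℕ)}
    (hl : ∀ c ∈ l, ∀ n, TermOn (G.yield (ofLex c).2 (ofLex c).1 n)
      fun v => v ∈ (ofLex c).1 ∨ (n < v ∧ v ≤ n + G.newCount (ofLex c).2)) (n : ℕ) :
    TermOn (G.yieldList l n)
      fun v => (∃ c ∈ l, v ∈ (ofLex c).1) ∨ (n < v ∧ v ≤ n + G.newCountList l) := by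
  induction l generalizing n with
  | nil => intro e he; simp [yieldList] at he
  | cons c l ih =>
    intro e he
    rw [yieldList, Multiset.mem_add] at he
    rw [newCountList_cons]
    rcases he with he | he
    · obtain ⟨h1, h2⟩ := hl c (by simp) n e he
      refine ⟨h1, fun v hv => ?_⟩
      rcases h2 v hv with h | h
      · exact Or.inl ⟨c, by simp, h⟩
      · right; omega
    · obtain ⟨h1, h2⟩ := ih (fun c' hc' => hl c' (List.mem_cons_of_mem _ hc')) _ e he
      refine ⟨h1, fun v hv => ?_⟩
      rcases h2 v hv with ⟨c', hc', h⟩ | h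
      · exact Or.inl ⟨c', List.mem_cons_of_mem _ hc', h⟩
      · right; omega

/-- The edges derived from a nonterminal are terminal, and are attached only to the nodes of the
replaced edge and to new nodes. -/
theorem yield_termOn (G : SLHRGrammar rk) {A : ℕ} (hA : A ∈ G.N) {att : List ℕ}
    (hlen : att.length = G.ntRank A) (n : ℕ) :
    TermOn (G.yield A att n) fun v => v ∈ att ∨ (n < v ∧ v ≤ n + G.newCount A) := by
  induction A using G.wellFounded_uses.induction generalizing att n with
  | _ A ih =>
    rw [← G.rhs_rank A hA] at hlen
    have hadm := G.admissible_rhs hA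
    have hnode : ∀ v ∈ Finset.Icc 1 (G.rhs A).n, (G.rhs A).nodeMap n att v ∈ att ∨
        (n < (G.rhs A).nodeMap n att v ∧ (G.rhs A).nodeMap n att v ≤ n + G.newCount A) := by
      intro v hv
      rw [G.newCount_eq hA]
      rcases nodeMap_mem (n := n) hlen hv with h | h
      · exact Or.inl h.2
      · right; omega
    intro e he
    rw [G.yield_eq hA, yieldGraph, Multiset.mem_add] at he
    rcases he with he | he
    · obtain ⟨e0, he0, rfl⟩ := Multiset.mem_map.1 he
      obtain ⟨he, a, ha⟩ := mem_termEdges.1 he0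
      refine ⟨⟨a, ha⟩, fun v hv => ?_⟩
      obtain ⟨v, hv', rfl⟩ := List.mem_map.1 hv
      exact hnode v (hadm.valid.att_mem e0 he v hv')
    · have hr := hadm.ranked ((G.rhs A).nodeMap n att)
      obtain ⟨h1, h2⟩ := yieldList_termOn (fun c hc n' => by
        obtain ⟨hN, hlen'⟩ := hr c hc
        obtain ⟨c', hc', rfl⟩ := List.mem_map.1 hc
        exact ih _ (G.uses_of_mem_siblings hA hc') hN hlen' n') _ e he
      refine ⟨h1, fun v hv => ?_⟩
      rcases h2 v hv with ⟨c, hc, h⟩ | h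
      · obtain ⟨c', hc', rfl⟩ := List.mem_map.1 hc
        obtain ⟨v, hv', rfl⟩ := List.mem_map.1 h
        exact hnode v (hadm.valid.att_mem _ (ntEdge_mem hc') v hv')
      · rw [newCountList_map_mapAtt] at h
        rw [G.newCount_eq hA]
        right; omega

theorem Ranked.termOn {G : SLHRGrammar rk} {l : List (List ℕ ×ₗ ℕ)} (hl : G.Ranked l) (n : ℕ) :
    TermOn (G.yieldList l n)
      fun v => (∃ c ∈ l, v ∈ (ofLex c).1) ∨ (n < v ∧ v ≤ n + G.newCountList l) :=
  yieldList_termOn (fun c hc n => G.yield_termOn (hl c hc).1 (hl c hc).2 n) n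

theorem Admissible.termOn {G : SLHRGrammar rk} {h : HGraph (T ⊕ ℕ)} (hh : G.Admissible h)
    (ν : ℕ → ℕ) (n : ℕ) :
    TermOn (G.yieldGraph h ν n) fun v =>
      (∃ u ∈ Finset.Icc 1 h.n, v = ν u) ∨ (n < v ∧ v ≤ n + G.newCountList h.siblings) := by
  intro e he
  rw [yieldGraph, Multiset.mem_add] at he
  rcases he with he | he
  · obtain ⟨e0, he0, rfl⟩ := Multiset.mem_map.1 he
    obtain ⟨he, a, ha⟩ := mem_termEdges.1 he0
    refine ⟨⟨a, ha⟩, fun v hv => ?_⟩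
    obtain ⟨v, hv', rfl⟩ := List.mem_map.1 hv
    exact Or.inl ⟨v, hh.valid.att_mem e0 he v hv', rfl⟩
  · obtain ⟨h1, h2⟩ := (hh.ranked ν).termOn n e he
    refine ⟨h1, fun v hv => ?_⟩
    rcases h2 v hv with ⟨c, hc, h⟩ | h
    · obtain ⟨c', hc', rfl⟩ := List.mem_map.1 hc
      obtain ⟨v, hv', rfl⟩ := List.mem_map.1 h
      exact Or.inl ⟨v, hh.valid.att_mem _ (ntEdge_mem hc') v hv', rfl⟩
    · rw [newCountList_map_mapAtt] at h
      exact Or.inr h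

/-- Every edge derived from a list of nonterminal edges is derived from one of them. -/
theorem mem_yieldList {G : SLHRGrammar rk} {l : List (List ℕ ×ₗ ℕ)} {n : ℕ}
    {e : HEdge (T ⊕ ℕ)} (he : e ∈ G.yieldList l n) :
    ∃ c ∈ l, ∃ k, n ≤ k ∧ e ∈ G.yield (ofLex c).2 (ofLex c).1 k ∧
      G.yield (ofLex c).2 (ofLex c).1 k ⊆ G.yieldList l n := by
  induction l generalizing n with
  | nil => simp [yieldList] at he
  | cons c l ih =>
    rw [yieldList] at he ⊢
    rcases Multiset.mem_add.1 he with he | he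
    · exact ⟨c, by simp, n, le_rfl, he, fun x hx => Multiset.mem_add.2 (Or.inl hx)⟩
    · obtain ⟨c', hc', k, hk, h1, h2⟩ := ih he
      exact ⟨c', List.mem_cons_of_mem _ hc', k, by omega, h1,
        fun x hx => Multiset.mem_add.2 (Or.inr (h2 hx))⟩

/-- The edges derived from one member of a list of nonterminal edges; the nodes created there are
not incident with any other derived edge. -/
theorem Ranked.exists_yield_subset {G : SLHRGrammar rk} {l : List (List ℕ ×ₗ ℕ)}
    (hl : G.Ranked l) {n : ℕ} (hatt : ∀ c ∈ l, ∀ v ∈ (ofLex c).1, v ≤ n) {c : List ℕ ×ₗ ℕ}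
    (hc : c ∈ l) :
    ∃ k, n ≤ k ∧ G.yield (ofLex c).2 (ofLex c).1 k ⊆ G.yieldList l n ∧
      ∀ e ∈ G.yieldList l n, (∃ v ∈ e.att, k < v ∧ v ≤ k + G.newCount (ofLex c).2) →
        e ∈ G.yield (ofLex c).2 (ofLex c).1 k := by
  induction l generalizing n with
  | nil => simp at hc
  | cons d l ih =>
    rw [yieldList]
    rcases List.mem_cons.1 hc with rfl | hc
    · refine ⟨n, le_rfl, fun x hx => Multiset.mem_add.2 (Or.inl hx), ?_⟩
      rintro e he ⟨v, hv, hv1, hv2⟩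
      rcases Multiset.mem_add.1 he with he | he
      · exact he
      · rcases (hl.of_cons.termOn _ e he).2 v hv with ⟨c', hc', h⟩ | h
        · have := hatt c' (List.mem_cons_of_mem _ hc') v h
          omega
        · omega
    · obtain ⟨k, hk, h1, h2⟩ := ih hl.of_cons (n := n + G.newCount (ofLex d).2)
        (fun c' hc' v hv => (hatt c' (List.mem_cons_of_mem _ hc') v hv).trans
          (Nat.le_add_right _ _)) hc
      refine ⟨k, by omega, fun x hx => Multiset.mem_add.2 (Or.inr (h1 hx)), ?_⟩
      rintro e he ⟨v, hv, hv1, hv2⟩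
      rcases Multiset.mem_add.1 he with he | he
      · rcases (G.yield_termOn (hl d (by simp)).1 (hl d (by simp)).2 n e he).2 v hv with h | h
        · have := hatt d (by simp) v h
          omega
        · omega
      · exact h2 e he ⟨v, hv, hv1, hv2⟩

theorem rename_rename {L : Type*} (ρ ν : ℕ → ℕ) (e : HEdge L) :
    (e.rename ν).rename ρ = e.rename (ρ ∘ ν) := by
  simp [HEdge.rename]

theorem rename_congr {L : Type*} {ρ ν : ℕ → ℕ} {e : HEdge L} (h : ∀ v ∈ e.att, ρ v = ν v) :
    e.rename ρ = e.rename ν := by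
  rw [HEdge.rename, HEdge.rename, List.map_congr_left h]

theorem yieldList_map {G : SLHRGrammar rk} {l : List (List ℕ ×ₗ ℕ)} {ρ : ℕ → ℕ} {n n' : ℕ}
    (hl : ∀ c ∈ l, ∀ n n' : ℕ, (∀ i, 1 ≤ i → i ≤ G.newCount (ofLex c).2 → ρ (n + i) = n' + i) →
      G.yield (ofLex c).2 ((ofLex c).1.map ρ) n' =
        (G.yield (ofLex c).2 (ofLex c).1 n).map (HEdge.rename ρ))
    (hρ : ∀ i, 1 ≤ i → i ≤ G.newCountList l → ρ (n + i) = n' + i) :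
    G.yieldList (l.map (mapAtt ρ)) n' = (G.yieldList l n).map (HEdge.rename ρ) := by
  induction l generalizing n n' with
  | nil => simp [yieldList]
  | cons c l ih =>
    rw [newCountList_cons] at hρ
    rw [List.map_cons, yieldList, yieldList, Multiset.map_add]
    congr 1
    · exact hl c (by simp) n n' fun i h1 h2 => hρ i h1 (by omega)
    · refine ih (fun c' hc' => hl c' (List.mem_cons_of_mem _ hc')) fun i h1 h2 => ?_
      have := hρ (G.newCount (ofLex c).2 + i) (by omega) (by omega)
      simpa only [mapAtt, ofLex_toLex, add_assoc] using this

/-- The derived edges depend on the attachment and on the numbers of the new nodes only through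
renaming. -/
theorem yield_map (G : SLHRGrammar rk) {A : ℕ} (hA : A ∈ G.N) {att : List ℕ}
    (hlen : att.length = G.ntRank A) {ρ : ℕ → ℕ} {n n' : ℕ}
    (hρ : ∀ i, 1 ≤ i → i ≤ G.newCount A → ρ (n + i) = n' + i) :
    G.yield A (att.map ρ) n' = (G.yield A att n).map (HEdge.rename ρ) := by
  induction A using G.wellFounded_uses.induction generalizing att n n' with
  | _ A ih =>
    rw [← G.rhs_rank A hA] at hlen
    have hadm := G.admissible_rhs hA
    rw [G.newCount_eq hA] at hρ
    have hν : ∀ v ∈ Finset.Icc 1 (G.rhs A).n, (G.rhs A).nodeMap n' (att.map ρ) v =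
        ρ ((G.rhs A).nodeMap n att v) := fun v hv =>
      nodeMap_map hlen hv fun i h1 h2 => hρ i h1 (by omega)
    rw [G.yield_eq hA, G.yield_eq hA, yieldGraph, yieldGraph, Multiset.map_add]
    congr 1
    · rw [Multiset.map_map]
      refine Multiset.map_congr rfl fun e he => ?_
      rw [Function.comp_apply, rename_rename]
      exact rename_congr fun v hv => hν v (hadm.valid.att_mem e (mem_termEdges.1 he).1 v hv)
    · have hmap : (G.rhs A).siblings.map (mapAtt ((G.rhs A).nodeMap n' (att.map ρ))) =
          ((G.rhs A).siblings.map (mapAtt ((G.rhs A).nodeMap n att))).map (mapAtt ρ) := by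
        rw [List.map_map]
        refine List.map_congr_left fun c hc => ?_
        simp only [mapAtt, Function.comp_apply, ofLex_toLex, List.map_map]
        congr 2
        exact List.map_congr_left fun v hv => hν v (hadm.valid.att_mem _ (ntEdge_mem hc) v hv)
      rw [hmap]
      have hr := hadm.ranked ((G.rhs A).nodeMap n att)
      refine yieldList_map (fun c hc n n' hcρ => ?_) fun i h1 h2 => ?_
      · obtain ⟨hN, hlen'⟩ := hr c hc
        obtain ⟨c', hc', rfl⟩ := List.mem_map.1 hc
        exact ih _ (G.uses_of_mem_siblings hA hc') hN hlen' hcρ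
      · rw [newCountList_map_mapAtt] at h2
        have := hρ ((G.rhs A).internal.card + i) (by omega) (by omega)
        simpa only [add_assoc] using this

end SLHRGrammar

/-! ### Linear hypergraphs and their walks -/

namespace HGraph

variable {T : Type*}

/-- There is an `a`-labelled edge from `u` to `v` among the edges `E`. -/
def Step (E : Multiset (HEdge (T ⊕ ℕ))) (u : ℕ) (a : T) (v : ℕ) : Prop :=
  (⟨Sum.inl a, [u, v]⟩ : HEdge (T ⊕ ℕ)) ∈ E

theorem Step.map {E : Multiset (HEdge (T ⊕ ℕ))} {u v : ℕ} {a : T} (h : Step E u a v)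
    (ρ : ℕ → ℕ) : Step (E.map (HEdge.rename ρ)) (ρ u) a (ρ v) :=
  Multiset.mem_map.2 ⟨_, h, rfl⟩

theorem step_of_rename {e : HEdge (T ⊕ ℕ)} {ρ : ℕ → ℕ} {a : T} {u v : ℕ}
    (h : e.rename ρ = ⟨Sum.inl a, [u, v]⟩) :
    ∃ u' v', e = ⟨Sum.inl a, [u', v']⟩ ∧ ρ u' = u ∧ ρ v' = v := by
  obtain ⟨lab, att⟩ := e
  simp only [HEdge.rename, HEdge.mk.injEq] at h
  obtain ⟨rfl, h⟩ := h
  match att, h with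
  | [u', v'], h =>
    simp only [List.map_cons, List.map_nil, List.cons.injEq, and_true] at h
    exact ⟨u', v', rfl, h.1, h.2⟩

/-- The edges `E` form a disjoint union of directed paths, as the edges of a subgraph of a
string-graph do, and no path ends in a node satisfying `I`. -/
structure Linear (E : Multiset (HEdge (T ⊕ ℕ))) (I : ℕ → Prop) : Prop where
  binary : ∀ e ∈ E, ∃ a u v, e = ⟨Sum.inl a, [u, v]⟩
  position : ∃ (p : ℕ → ℕ) (K : ℕ), ∀ u a v, Step E u a v → p v = p u + 1 ∧ p v ≤ K
  out_unique : ∀ {u a v a' v'}, Step E u a v → Step E u a' v' → a = a' ∧ v = v'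
  in_unique : ∀ {u a v u' a'}, Step E u a v → Step E u' a' v → u = u'
  continues : ∀ {u a v}, Step E u a v → I v → ∃ b w, Step E v b w

/-- `IWalk E I u l z`: there is a nonempty walk from `u` to `z` along edges in `E` whose
intermediate nodes satisfy `I`; the list `l` records the source and the label of each step. -/
inductive IWalk (E : Multiset (HEdge (T ⊕ ℕ))) (I : ℕ → Prop) : ℕ → List (ℕ × T) → ℕ → Prop
  | single {u a v} (h : Step E u a v) : IWalk E I u [(u, a)] v
  | cons {u a v l z} (h : Step E u a v) (hv : I v) (hl : IWalk E I v l z) :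
      IWalk E I u ((u, a) :: l) z

namespace IWalk

variable {E : Multiset (HEdge (T ⊕ ℕ))} {I J : ℕ → Prop} {u z : ℕ} {l : List (ℕ × T)}

theorem map {E' : Multiset (HEdge (T ⊕ ℕ))} {ρ : ℕ → ℕ} (h : IWalk E I u l z)
    (hE : E.map (HEdge.rename ρ) ⊆ E') (hI : ∀ u a v, Step E u a v → I v → J (ρ v)) :
    IWalk E' J (ρ u) (l.map (Prod.map ρ id)) (ρ z) := by
  induction h with
  | single h => exact single (hE (h.map ρ))
  | cons h hv _ ih => exact cons (hE (h.map ρ)) (hI _ _ _ h hv) ih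

/-- A walk that may only pass through fewer nodes is an initial part of any walk from the same
node that leaves the set `I` at its end. -/
theorem eq_or_exists_append (hE : Linear E I) {l₁ : List (ℕ × T)} {z₁ : ℕ}
    (h₁ : IWalk E J u l₁ z₁) (hJ : ∀ v, J v → I v) (h : IWalk E I u l z) (hz : ¬ I z) :
    (l = l₁ ∧ z = z₁) ∨ (I z₁ ∧ ∃ l₂, l = l₁ ++ l₂ ∧ IWalk E I z₁ l₂ z) := by
  induction h₁ generalizing l with
  | single h₁ =>
    cases h with
    | single h => obtain ⟨rfl, rfl⟩ := hE.out_unique h₁ h; exact Or.inl ⟨rfl, rfl⟩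
    | cons h hv hl =>
      obtain ⟨rfl, rfl⟩ := hE.out_unique h₁ h
      exact Or.inr ⟨hv, _, rfl, hl⟩
  | cons h₁ hv₁ _ ih =>
    cases h with
    | single h =>
      obtain ⟨rfl, rfl⟩ := hE.out_unique h₁ h
      exact absurd (hJ _ hv₁) hz
    | cons h hv hl =>
      obtain ⟨rfl, rfl⟩ := hE.out_unique h₁ h
      rcases ih hl with ⟨rfl, rfl⟩ | ⟨h1, l₂, rfl, h2⟩
      · exact Or.inl ⟨rfl, rfl⟩
      · exact Or.inr ⟨h1, l₂, rfl, h2⟩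

theorem nodup (hE : Linear E I) (h : IWalk E I u l z) : (l.map Prod.fst).Nodup := by
  obtain ⟨p, K, hp⟩ := hE.position
  suffices (l.map Prod.fst).Nodup ∧ ∀ x ∈ l.map Prod.fst, p u ≤ p x from this.1
  induction h with
  | single h => simp
  | @cons u a v l z h hv hl ih =>
    have h1 := (hp _ _ _ h).1
    simp only [List.map_cons, List.nodup_cons, List.forall_mem_cons, le_refl, true_and]
    refine ⟨⟨fun hu => ?_, ih.1⟩, fun x hx => ?_⟩
    · have := ih.2 u hu; omega
    · have := ih.2 x hx; omega

theorem reflTransGen (h : IWalk E I u l z) {x : ℕ} (hx : x ∈ l.map Prod.fst) :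
    Relation.ReflTransGen (fun b c => I c ∧ ∃ a, Step E b a c) u x := by
  induction h with
  | single h =>
    simp only [List.map_cons, List.map_nil, List.mem_singleton] at hx
    subst hx; exact .refl
  | cons h hv _ ih =>
    rw [List.map_cons, List.mem_cons] at hx
    rcases hx with rfl | hx
    · exact .refl
    · exact .head ⟨hv, _, h⟩ (ih hx)

/-- Walks from different nodes outside `I` have no source in common. -/
theorem start_unique (hE : Linear E I) {u' z' : ℕ} {l' : List (ℕ × T)} (h : IWalk E I u l z)
    (h' : IWalk E I u' l' z') (hu : ¬ I u) (hu' : ¬ I u') {x : ℕ} (hx : x ∈ l.map Prod.fst)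
    (hx' : x ∈ l'.map Prod.fst) : u = u' := by
  have h1 := h.reflTransGen hx
  have h2 := h'.reflTransGen hx'
  clear hx hx'
  induction h1 with
  | refl =>
    cases h2 with
    | refl => rfl
    | tail _ h2 => exact absurd h2.1 hu
  | tail _ h1 ih =>
    cases h2 with
    | refl => exact absurd h1.1 hu'
    | tail h2 h3 =>
      obtain ⟨_, a, ha⟩ := h1
      obtain ⟨_, a', ha'⟩ := h3
      exact ih (hE.in_unique ha ha' ▸ h2)

end IWalk

namespace Linear

variable {E : Multiset (HEdge (T ⊕ ℕ))} {I : ℕ → Prop}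

/-- From a node with an outgoing edge, one can walk until a node outside `I` is reached. -/
theorem exists_walk (hE : Linear E I) {u : ℕ} (hu : ∃ b w, Step E u b w) :
    ∃ l z, IWalk E I u l z ∧ ¬ I z := by
  obtain ⟨p, K, hp⟩ := hE.position
  induction hk : K - p u generalizing u with
  | zero =>
    obtain ⟨b, w, h⟩ := hu
    have := hp _ _ _ h
    omega
  | succ k ih =>
    obtain ⟨b, w, h⟩ := hu
    by_cases hw : I w
    · have := hp _ _ _ h
      obtain ⟨l, z, hl, hz⟩ := ih (hE.continues h hw) (by omega)
      exact ⟨_, z, .cons h hw hl, hz⟩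
    · exact ⟨_, w, .single h, hw⟩

/-- Linearity passes to a set of edges `E'` that is embedded in `E` by an injective renaming,
provided that `E` has no further edges at the nodes whose paths have to continue. -/
theorem pullback {E' : Multiset (HEdge (T ⊕ ℕ))} {I' : ℕ → Prop} {ρ : ℕ → ℕ} {s : Set ℕ}
    (hE : Linear E I) (hsub : E'.map (HEdge.rename ρ) ⊆ E) (hs : ∀ e ∈ E', ∀ v ∈ e.att, v ∈ s)
    (hρ : Set.InjOn ρ s)
    (hI : ∀ v ∈ s, I' v → I (ρ v) ∧ ∀ e ∈ E, ρ v ∈ e.att → e ∈ E'.map (HEdge.rename ρ)) :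
    Linear E' I' := by
  have hstep : ∀ {u a v}, Step E' u a v → Step E (ρ u) a (ρ v) := fun h => hsub (h.map ρ)
  have hmem : ∀ {u a v}, Step E' u a v → u ∈ s ∧ v ∈ s := fun h =>
    ⟨hs _ h _ (by simp), hs _ h _ (by simp)⟩
  refine ⟨fun e he => ?_, ?_, fun h h' => ?_, fun h h' => ?_, fun {u a v} h hv => ?_⟩
  · obtain ⟨a, u, v, h⟩ := hE.binary _ (hsub (Multiset.mem_map_of_mem _ he))
    obtain ⟨u', v', h, -⟩ := step_of_rename h
    exact ⟨a, u', v', h⟩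
  · obtain ⟨p, K, hp⟩ := hE.position
    exact ⟨p ∘ ρ, K, fun u a v h => hp _ _ _ (hstep h)⟩
  · obtain ⟨h1, h2⟩ := hE.out_unique (hstep h) (hstep h')
    exact ⟨h1, hρ (hmem h).2 (hmem h').2 h2⟩
  · exact hρ (hmem h).1 (hmem h').1 (hE.in_unique (hstep h) (hstep h'))
  · obtain ⟨h1, h2⟩ := hI v (hmem h).2 hv
    obtain ⟨b, w, hw⟩ := hE.continues (hstep h) h1
    obtain ⟨e, he, hew⟩ := Multiset.mem_map.1 (h2 _ hw (by simp))
    obtain ⟨v', w', rfl, hv', -⟩ := step_of_rename hew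
    obtain rfl := hρ (hmem he).1 (hmem h).2 hv'
    exact ⟨b, w', he⟩

end Linear

end HGraph

namespace SLHRGrammar

open HGraph

variable {T : Type*} {rk : T → ℕ}

/-- The hypergraph derived from `A` is given by its edges: the nodes `1, …, rank A` are the
external ones, the nodes above `rank A` the internal ones. -/
noncomputable def valueEdges (G : SLHRGrammar rk) (A : ℕ) : Multiset (HEdge (T ⊕ ℕ)) :=
  G.yield A (List.range' 1 (G.ntRank A)) (G.ntRank A)

/-- The embedding of the hypergraph derived from a nonterminal when an edge attached to `att` is
derived in a graph with `n` nodes. -/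
def embed (att : List ℕ) (n v : ℕ) : ℕ :=
  if h : 1 ≤ v ∧ v ≤ att.length then att[v - 1] else n + (v - att.length)

theorem embed_of_gt {att : List ℕ} {n v : ℕ} (h : att.length < v) :
    embed att n v = n + (v - att.length) := dif_neg (by omega)

theorem embed_of_le {att : List ℕ} {n v : ℕ} (h1 : 1 ≤ v) (h : v ≤ att.length) :
    embed att n v = att[v - 1] := dif_pos ⟨h1, h⟩

theorem map_embed (att : List ℕ) (n : ℕ) :
    (List.range' 1 att.length).map (embed att n) = att := by
  refine List.ext_getElem (by simp) fun i h1 h2 => ?_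
  rw [List.getElem_map, List.getElem_range', embed_of_le (by omega) (by omega)]
  congr 1; omega

theorem embed_injOn {att : List ℕ} {n : ℕ} (hnd : att.Nodup) (hatt : ∀ v ∈ att, v ≤ n) :
    Set.InjOn (embed att n) {v | 1 ≤ v} := by
  intro u hu v hv huv
  simp only [Set.mem_ofPred_eq] at hu hv
  rcases le_or_gt u att.length with h | h <;> rcases le_or_gt v att.length with h' | h'
  · rw [embed_of_le hu h, embed_of_le hv h'] at huv
    have := (hnd.getElem_inj_iff).1 huv
    omega
  · rw [embed_of_le hu h, embed_of_gt h'] at huv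
    have := hatt _ (List.getElem_mem (by omega : u - 1 < att.length))
    omega
  · rw [embed_of_le hv h', embed_of_gt h] at huv
    have := hatt _ (List.getElem_mem (by omega : v - 1 < att.length))
    omega
  · rw [embed_of_gt h, embed_of_gt h'] at huv
    omega

/-- Every complete derivation of `A` yields a renamed copy of the hypergraph derived from `A`. -/
theorem yield_eq_map_valueEdges (G : SLHRGrammar rk) {A : ℕ} (hA : A ∈ G.N) {att : List ℕ}
    (hlen : att.length = G.ntRank A) (n : ℕ) :
    G.yield A att n = (G.valueEdges A).map (HEdge.rename (embed att n)) := by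
  rw [valueEdges, ← yield_map G hA (by simp) (n' := n), ← hlen, map_embed]
  intro i h1 h2
  rw [embed_of_gt (by omega)]
  omega

theorem valueEdges_termOn (G : SLHRGrammar rk) {A : ℕ} (hA : A ∈ G.N) :
    TermOn (G.valueEdges A) fun v => 1 ≤ v ∧ v ≤ G.ntRank A + G.newCount A := by
  intro e he
  obtain ⟨h1, h2⟩ := G.yield_termOn hA (List.length_range' ..) _ e he
  refine ⟨h1, fun v hv => ?_⟩
  rcases h2 v hv with h | h
  · rw [List.mem_range'_1] at h
    omega
  · omega

/-- A copy of `h`, embedded by `ν` in a graph with `n` nodes, whose complete derivation yields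
disjoint paths; the predicate `I` singles out the images of the internal nodes and all new
nodes. -/
structure Embedded (G : SLHRGrammar rk) (h : HGraph (T ⊕ ℕ)) (ν : ℕ → ℕ) (n : ℕ)
    (I : ℕ → Prop) : Prop where
  admissible : G.Admissible h
  injOn : Set.InjOn ν (Set.Icc 1 h.n)
  le : ∀ v ∈ Finset.Icc 1 h.n, ν v ≤ n
  new : ∀ v, n < v → I v
  node : ∀ v ∈ Finset.Icc 1 h.n, I (ν v) ↔ v ∉ h.ext
  linear : Linear (G.yieldGraph h ν n) I

theorem Embedded.att_mem {G : SLHRGrammar rk} {h : HGraph (T ⊕ ℕ)} {ν : ℕ → ℕ} {n : ℕ}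
    {I : ℕ → Prop} (H : G.Embedded h ν n I) {c : List ℕ ×ₗ ℕ} (hc : c ∈ h.siblings) :
    ((ofLex c).1.map ν).length = G.ntRank (ofLex c).2 ∧ ((ofLex c).1.map ν).Nodup ∧
      ∀ v ∈ (ofLex c).1.map ν, v ≤ n := by
  have hm := fun v hv => H.admissible.valid.att_mem _ (ntEdge_mem hc) v hv
  refine ⟨(H.admissible.ranked ν _ (List.mem_map_of_mem hc)).2, ?_, fun v hv => ?_⟩
  · refine (H.admissible.valid.att_nodup _ (ntEdge_mem hc)).map_on fun u hu v hv huv => ?_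
    exact H.injOn (Finset.mem_Icc.1 (hm u hu)) (Finset.mem_Icc.1 (hm v hv)) huv
  · obtain ⟨v, hv', rfl⟩ := List.mem_map.1 hv
    exact H.le v (hm v hv')

/-- A nonterminal occurring in a hypergraph that yields disjoint paths itself yields disjoint paths:
its internal nodes are new, so that both their edges come from that nonterminal. -/
theorem Embedded.linear_valueEdges {G : SLHRGrammar rk} {h : HGraph (T ⊕ ℕ)} {ν : ℕ → ℕ} {n : ℕ}
    {I : ℕ → Prop} (H : G.Embedded h ν n I) {c : List ℕ ×ₗ ℕ} (hc : c ∈ h.siblings) :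
    Linear (G.valueEdges (ofLex c).2) fun v => G.ntRank (ofLex c).2 < v := by
  obtain ⟨hlen, hnd, hle⟩ := H.att_mem hc
  have hr := H.admissible.ranked ν
  have hN := (hr _ (List.mem_map_of_mem hc)).1
  obtain ⟨k, hk, hsub, hfresh⟩ := hr.exists_yield_subset (n := n) (fun c' hc' => by
    obtain ⟨d, hd, rfl⟩ := List.mem_map.1 hc'
    exact (H.att_mem hd).2.2) (List.mem_map_of_mem hc)
  simp only [mapAtt, ofLex_toLex] at hN hsub hfresh
  rw [G.yield_eq_map_valueEdges hN hlen] at hsub hfresh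
  refine H.linear.pullback (ρ := embed ((ofLex c).1.map ν) k)
    (s := {v | 1 ≤ v ∧ v ≤ G.ntRank (ofLex c).2 + G.newCount (ofLex c).2})
    (fun e he => Multiset.mem_add.2 (Or.inr (hsub he)))
    (fun e he v hv => (G.valueEdges_termOn hN e he).2 v hv)
    ((embed_injOn hnd fun v hv => (hle v hv).trans hk).mono fun v hv => hv.1) ?_
  intro v hv hv'
  have hv2 := hv.2
  rw [embed_of_gt (hlen ▸ hv')]
  refine ⟨H.new _ (by omega), fun e he hev => ?_⟩
  rcases Multiset.mem_add.1 he with he | he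
  · obtain ⟨e0, he0, rfl⟩ := Multiset.mem_map.1 he
    obtain ⟨w, hw, hw'⟩ := List.mem_map.1 hev
    have := H.le w (H.admissible.valid.att_mem _ (mem_termEdges.1 he0).1 w hw)
    omega
  · exact hfresh e he ⟨_, hev, by omega, by omega⟩

theorem embedded_rhs (G : SLHRGrammar rk) {A : ℕ} (hA : A ∈ G.N)
    (hlin : Linear (G.valueEdges A) fun v => G.ntRank A < v) :
    G.Embedded (G.rhs A) ((G.rhs A).nodeMap (G.ntRank A) (List.range' 1 (G.ntRank A)))
      (G.ntRank A + (G.rhs A).internal.card) (fun v => G.ntRank A < v) := by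
  have hlen : (List.range' 1 (G.ntRank A)).length = (G.rhs A).rank := by
    rw [List.length_range', G.rhs_rank A hA]
  have hmem : ∀ v ∈ List.range' 1 (G.ntRank A), v ≤ G.ntRank A := fun v hv => by
    rw [List.mem_range'_1] at hv; omega
  refine ⟨G.admissible_rhs hA, nodeMap_injOn hlen hmem List.nodup_range', fun v hv => ?_,
    fun v hv => by omega, fun v hv => ?_, ?_⟩
  · rcases nodeMap_mem (n := G.ntRank A) hlen hv with h | h
    · have := hmem _ h.2; omega
    · omega
  · rcases nodeMap_mem (n := G.ntRank A) hlen hv with h | h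
    · have := hmem _ h.2
      exact ⟨fun h' => by omega, fun h' => absurd h.1 h'⟩
    · exact ⟨fun _ => h.1, fun _ => h.2.1⟩
  · rw [← G.yield_eq hA]; exact hlin

/-- In a grammar generating disjoint paths, every nonterminal generates disjoint paths, whose ends
are external. -/
theorem linear_of_embedded_start (G : SLHRGrammar rk) {I : ℕ → Prop}
    (H : G.Embedded G.start id G.start.n I) {A : ℕ} (hA : A ∈ G.N) :
    Linear (G.valueEdges A) fun v => G.ntRank A < v := by
  obtain ⟨e, he, B, hB, hBA⟩ := G.reachable A hA
  clear hA
  induction hBA with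
  | refl => exact H.linear_valueEdges (mem_siblings he hB)
  | tail _ h ih =>
    obtain ⟨hN, e', he', hl⟩ := h
    exact (G.embedded_rhs hN ih).linear_valueEdges (mem_siblings he' hl)

end SLHRGrammar

/-! ### Walks along a string-graph and their segments -/

namespace HGraph

variable {T : Type*}

theorem mem_sGraph_edges {L : Type*} {w : List L} {e : HEdge L} :
    e ∈ (sGraph w).edges ↔ ∃ i, ∃ hi : i < w.length, e = ⟨w[i], [i + 1, i + 2]⟩ := by
  simp only [sGraph, Multiset.mem_coe, List.mem_ofFn]
  constructor
  · rintro ⟨i, rfl⟩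
    exact ⟨i, i.2, rfl⟩
  · rintro ⟨i, hi, rfl⟩
    exact ⟨⟨i, hi⟩, rfl⟩

theorem Step.of_sGraph {g : HGraph (T ⊕ ℕ)} {w : List (T ⊕ ℕ)} {σ : ℕ → ℕ}
    (hσ : g.edges.map (HEdge.rename σ) = (sGraph w).edges) {u v : ℕ} {a : T}
    (h : Step g.edges u a v) :
    ∃ i, ∃ hi : i < w.length, w[i] = Sum.inl a ∧ σ u = i + 1 ∧ σ v = i + 2 := by
  have h1 := h.map σ
  rw [hσ] at h1
  obtain ⟨i, hi, h2⟩ := mem_sGraph_edges.1 h1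
  simp only [HEdge.mk.injEq, List.cons.injEq, and_true] at h2
  exact ⟨i, hi, h2.1.symm, h2.2.1, h2.2.2⟩

/-- `σ` is an isomorphism from `g`, a hypergraph with terminal edges only, to the hypergraph of the
string `w`. -/
structure StringIso (g : HGraph (T ⊕ ℕ)) (w : List (T ⊕ ℕ)) (σ : ℕ → ℕ) : Prop where
  edges : ∀ e ∈ g.edges, (∃ a, e.lab = Sum.inl a) ∧ ∀ v ∈ e.att, v ∈ Set.Icc 1 g.n
  ext : ∀ v ∈ g.ext, v ∈ Set.Icc 1 g.n
  bij : Set.BijOn σ (Set.Icc 1 g.n) (Set.Icc 1 (w.length + 1))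
  map_edges : g.edges.map (HEdge.rename σ) = (sGraph w).edges
  map_ext : g.ext.map σ = [1, w.length + 1]

namespace StringIso

variable {g : HGraph (T ⊕ ℕ)} {w : List (T ⊕ ℕ)} {σ : ℕ → ℕ}

theorem exists_eq_step (S : StringIso g w σ) {e : HEdge (T ⊕ ℕ)} {i : ℕ} {hi : i < w.length}
    (he : e ∈ g.edges) (h : e.rename σ = ⟨w[i], [i + 1, i + 2]⟩) :
    ∃ a u v, e = ⟨Sum.inl a, [u, v]⟩ ∧ σ u = i + 1 ∧ σ v = i + 2 := by
  obtain ⟨⟨a, ha⟩, -⟩ := S.edges e he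
  have hw : w[i] = Sum.inl a := by
    rw [← ha]; exact (congrArg HEdge.lab h).symm
  rw [hw] at h
  obtain ⟨u, v, h⟩ := step_of_rename h
  exact ⟨a, u, v, h⟩

theorem exists_step (S : StringIso g w σ) {u : ℕ} (hu : u ∈ Set.Icc 1 g.n)
    (hlt : σ u ≤ w.length) :
    ∃ a v, Step g.edges u a v := by
  have h1 := (S.bij.mapsTo hu).1
  have hmem : (⟨w[σ u - 1], [(σ u - 1) + 1, (σ u - 1) + 2]⟩ : HEdge (T ⊕ ℕ)) ∈
      (sGraph w).edges := mem_sGraph_edges.2 ⟨σ u - 1, by omega, rfl⟩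
  rw [← S.map_edges] at hmem
  obtain ⟨e, he, h⟩ := Multiset.mem_map.1 hmem
  obtain ⟨a, u', v, rfl, hu', -⟩ := S.exists_eq_step he h
  obtain rfl := S.bij.injOn ((S.edges _ he).2 u' (by simp)) hu (by omega)
  exact ⟨a, v, he⟩

/-- A hypergraph that is isomorphic to a string-graph is linear. -/
theorem linear (S : StringIso g w σ) : Linear g.edges (· ∉ g.ext) := by
  have hmem : ∀ {u a v}, Step g.edges u a v → u ∈ Set.Icc 1 g.n ∧ v ∈ Set.Icc 1 g.n := fun h =>
    ⟨(S.edges _ h).2 _ (by simp), (S.edges _ h).2 _ (by simp)⟩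
  refine ⟨fun e he => ?_, ⟨σ, w.length + 1, fun u a v h => ?_⟩, fun h h' => ?_, fun h h' => ?_,
    fun {u a v} h hv => ?_⟩
  · have h1 := Multiset.mem_map_of_mem (HEdge.rename σ) he
    rw [S.map_edges] at h1
    obtain ⟨i, hi, h1⟩ := mem_sGraph_edges.1 h1
    obtain ⟨a, u, v, h, -⟩ := S.exists_eq_step he h1
    exact ⟨a, u, v, h⟩
  · obtain ⟨i, hi, -, h1, h2⟩ := h.of_sGraph S.map_edges
    omega
  · obtain ⟨i, hi, h0, h1, h2⟩ := h.of_sGraph S.map_edges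
    obtain ⟨j, hj, h3, h4, h5⟩ := h'.of_sGraph S.map_edges
    obtain rfl : i = j := by omega
    exact ⟨Sum.inl_injective (h0.symm.trans h3), S.bij.injOn (hmem h).2 (hmem h').2 (by omega)⟩
  · obtain ⟨i, hi, h0, h1, h2⟩ := h.of_sGraph S.map_edges
    obtain ⟨j, hj, h3, h4, h5⟩ := h'.of_sGraph S.map_edges
    exact S.bij.injOn (hmem h).1 (hmem h').1 (by omega)
  · obtain ⟨i, hi, h0, h1, h2⟩ := h.of_sGraph S.map_edges
    refine S.exists_step (hmem h).2 ?_
    by_contra hlt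
    have hlast : w.length + 1 ∈ g.ext.map σ := by rw [S.map_ext]; simp
    obtain ⟨z, hz, hz'⟩ := List.mem_map.1 hlast
    obtain rfl := S.bij.injOn (S.ext z hz) (hmem h).2 (by omega)
    exact hv hz

/-- A walk from the node at position `i` to the end of the string reads the rest of the string. -/
theorem word_eq_drop (S : StringIso g w σ) {u z : ℕ} {l : List (ℕ × T)}
    (h : IWalk g.edges (· ∉ g.ext) u l z) (hz : σ z = 1 ∨ σ z = w.length + 1) (i : ℕ) (hi : σ u = i + 1) :
    l.map (fun x => Sum.inl x.2) = w.drop i := by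
  induction h generalizing i with
  | single h =>
    obtain ⟨j, hj, h0, h1, h2⟩ := h.of_sGraph S.map_edges
    obtain rfl : j = i := by omega
    rw [List.drop_eq_getElem_cons hj, List.drop_eq_nil_of_le (by omega), h0]
    rfl
  | cons h hv _ ih =>
    obtain ⟨j, hj, h0, h1, h2⟩ := h.of_sGraph S.map_edges
    obtain rfl : j = i := by omega
    rw [List.drop_eq_getElem_cons hj, h0, ← ih hz (j + 1) h2]
    rfl

/-- The string is read along a walk between the two external nodes. -/
theorem exists_walk (S : StringIso g w σ) (hw : w ≠ []) :
    ∃ u l z, u ∈ g.ext ∧ z ∈ g.ext ∧ IWalk g.edges (· ∉ g.ext) u l z ∧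
      l.map (fun x => Sum.inl x.2) = w := by
  have hfirst : 1 ∈ g.ext.map σ := by rw [S.map_ext]; simp
  obtain ⟨u, hu, hu'⟩ := List.mem_map.1 hfirst
  have hpos := List.length_pos_of_ne_nil hw
  obtain ⟨l, z, hl, hz⟩ := S.linear.exists_walk
    (S.exists_step (S.ext u hu) (by omega))
  have hz' : z ∈ g.ext := by simpa using hz
  refine ⟨u, l, z, hu, hz', hl, ?_⟩
  have hz2 : σ z ∈ g.ext.map σ := List.mem_map_of_mem hz'
  rw [S.map_ext] at hz2
  exact S.word_eq_drop hl (by simpa using hz2) 0 hu'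

end StringIso

theorem IWalk.exists_last {E : Multiset (HEdge (T ⊕ ℕ))} {I : ℕ → Prop} {u z : ℕ}
    {l : List (ℕ × T)} (h : IWalk E I u l z) : ∃ v a, Step E v a z := by
  induction h with
  | single h => exact ⟨_, _, h⟩
  | cons _ _ _ ih => exact ih

theorem IWalk.exists_cons {E : Multiset (HEdge (T ⊕ ℕ))} {I : ℕ → Prop} {u z : ℕ}
    {l : List (ℕ × T)} (h : IWalk E I u l z) : ∃ a t, l = (u, a) :: t ∧ ∃ v, Step E u a v := by
  cases h with
  | single h => exact ⟨_, _, rfl, _, h⟩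
  | cons h => exact ⟨_, _, rfl, _, h⟩

end HGraph

namespace SLHRGrammar

open HGraph

variable {T : Type*} {rk : T → ℕ}

/-- The number `x` encodes a pair `(A, i)` where `i` is an external node of the hypergraph derived
from the nonterminal `A` at which a path starts. -/
def IsSegment (G : SLHRGrammar rk) (x : ℕ) : Prop :=
  x.unpair.1 ∈ G.N ∧ 1 ≤ x.unpair.2 ∧ x.unpair.2 ≤ G.ntRank x.unpair.1 ∧
    ∃ b w, Step (G.valueEdges x.unpair.1) x.unpair.2 b w

open Classical in
/-- The walk in the hypergraph derived from `A` that leads from the external node `i` to the next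
external node on its path, where `x` encodes `(A, i)`; empty if there is none. -/
noncomputable def segment (G : SLHRGrammar rk) (x : ℕ) : List (ℕ × T) :=
  if h : ∃ l z, IWalk (G.valueEdges x.unpair.1) (G.ntRank x.unpair.1 < ·) x.unpair.2 l z ∧
    ¬ G.ntRank x.unpair.1 < z then h.choose else []

/-- The word along a segment. -/
noncomputable def segmentWord (G : SLHRGrammar rk) (x : ℕ) : List T :=
  (G.segment x).map Prod.snd

/-- The word denoted by a string of terminals and segments. -/
noncomputable def expand (G : SLHRGrammar rk) (ws : List (T ⊕ ℕ)) : List T :=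
  ws.flatMap (Sum.elim (fun a => [a]) G.segmentWord)

theorem IsSegment.walk {G : SLHRGrammar rk} {x : ℕ} (hx : G.IsSegment x)
    (hlin : Linear (G.valueEdges x.unpair.1) (G.ntRank x.unpair.1 < ·)) :
    ∃ z, IWalk (G.valueEdges x.unpair.1) (G.ntRank x.unpair.1 < ·) x.unpair.2 (G.segment x) z ∧
      1 ≤ z ∧ z ≤ G.ntRank x.unpair.1 := by
  have h := hlin.exists_walk hx.2.2.2
  rw [segment, dif_pos h]
  obtain ⟨z, hz, hz'⟩ := h.choose_spec
  obtain ⟨v, a, hv⟩ := hz.exists_last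
  exact ⟨z, hz, ((G.valueEdges_termOn hx.1 _ hv).2 z (by simp)).1, not_lt.1 hz'⟩

/-- The labels that may occur in the new rules made from a hypergraph `h`: terminals of rank two,
and segments of nonterminals that occur in `h`. -/
def RuleLabel (G : SLHRGrammar rk) (h : HGraph (T ⊕ ℕ)) : T ⊕ ℕ → Prop
  | Sum.inl a => rk a = 2
  | Sum.inr x => G.IsSegment x ∧ ∃ e ∈ h.edges, e.lab = Sum.inr x.unpair.1

/-- A path that leaves a node of `h` reaches another node of `h` either along a terminal edge of
`h`, or along a segment of a nonterminal edge of `h`. -/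
theorem Embedded.exists_piece {G : SLHRGrammar rk} {h : HGraph (T ⊕ ℕ)} {ν : ℕ → ℕ} {n : ℕ}
    {I : ℕ → Prop} (H : G.Embedded h ν n I)
    (hlin : ∀ A ∈ G.N, Linear (G.valueEdges A) (G.ntRank A < ·)) {v : ℕ}
    (hv : v ∈ Finset.Icc 1 h.n) (hstep : ∃ b w, Step (G.yieldGraph h ν n) (ν v) b w) :
    ∃ lab l v', G.RuleLabel h lab ∧ (∃ e ∈ h.edges, v ∈ e.att) ∧ v' ∈ Finset.Icc 1 h.n ∧
      IWalk (G.yieldGraph h ν n) (n < ·) (ν v) l (ν v') ∧ l.map Prod.snd = G.expand [lab] := by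
  obtain ⟨b, w, hbw⟩ := hstep
  have hinj : ∀ {u}, u ∈ Finset.Icc 1 h.n → ν u = ν v → u = v := fun hu he =>
    H.injOn (Finset.mem_Icc.1 hu) (Finset.mem_Icc.1 hv) he
  rcases Multiset.mem_add.1 hbw with he | he
  · obtain ⟨e, he0, hew⟩ := Multiset.mem_map.1 he
    obtain ⟨u, v', rfl, hu, rfl⟩ := step_of_rename hew
    replace he := (mem_termEdges.1 he0).1
    have hmem := H.admissible.valid.att_mem _ he
    obtain rfl := hinj (hmem u (by simp)) hu
    exact ⟨Sum.inl b, _, v', (H.admissible.valid.rank_lab _ he).symm, ⟨_, he, by simp⟩,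
      hmem v' (by simp), .single hbw, rfl⟩
  · obtain ⟨c, hc, k, hk, hek, hsub⟩ := mem_yieldList he
    obtain ⟨c, hc', rfl⟩ := List.mem_map.1 hc
    obtain ⟨hlen, hnd, hle⟩ := H.att_mem hc'
    have hN := H.admissible.closed _ (ntEdge_mem hc') _ rfl
    obtain ⟨att, A⟩ := c
    change List ℕ at att
    change ℕ at A
    have hmem : ∀ u ∈ att, u ∈ Finset.Icc 1 h.n :=
      H.admissible.valid.att_mem _ (ntEdge_mem hc')
    change A ∈ G.N at hN
    change (att.map ν).length = G.ntRank A at hlen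
    change ∀ u ∈ att.map ν, u ≤ n at hle
    change _ ∈ G.yield A (att.map ν) k at hek
    change G.yield A (att.map ν) k ⊆ _ at hsub
    rw [G.yield_eq_map_valueEdges hN hlen] at hek hsub
    obtain ⟨e1, he1, hew⟩ := Multiset.mem_map.1 hek
    obtain ⟨i, y, rfl, hi, -⟩ := step_of_rename hew
    have hi1 := ((G.valueEdges_termOn hN _ he1).2 i (by simp)).1
    have hi2 : i ≤ (att.map ν).length := by
      by_contra hlt
      rw [embed_of_gt (by omega)] at hi
      have := H.le v hv
      omega
    have hlen' : att.length = (att.map ν).length := (List.length_map _).symm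
    have hseg : G.IsSegment (Nat.pair A i) := by
      rw [IsSegment, Nat.unpair_pair]
      exact ⟨hN, hi1, hlen ▸ hi2, b, y, he1⟩
    obtain ⟨z, hz, hz1, hz2⟩ := hseg.walk (by rw [Nat.unpair_pair]; exact hlin A hN)
    rw [Nat.unpair_pair] at hz hz2
    simp only at hz hz2
    have hiv : att[i - 1] = v := by
      refine hinj (hmem _ (List.getElem_mem _)) ?_
      rw [← hi, embed_of_le hi1 hi2, List.getElem_map]
    have hw := hz.map (ρ := embed (att.map ν) k) (E' := G.yieldGraph h ν n) (J := (n < ·))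
      (fun e he => Multiset.mem_add.2 (Or.inr (hsub he))) (fun u a x _ hx => by
        rw [embed_of_gt (hlen ▸ hx)]; omega)
    rw [hi, embed_of_le hz1 (hlen ▸ hz2), List.getElem_map] at hw
    refine ⟨Sum.inr (Nat.pair A i), _, att[z - 1], ⟨hseg, _, ntEdge_mem hc', ?_⟩,
      ⟨_, ntEdge_mem hc', ?_⟩, hmem _ (List.getElem_mem _), hw, ?_⟩
    · rw [Nat.unpair_pair]; rfl
    · rw [← hiv]; exact List.getElem_mem _
    · simp [expand, segmentWord, List.map_map, Function.comp_def]

/-- The steps `l` of a walk in the hypergraph derived from `h` are cut into pieces that begin in the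
nodes `vs` of `h` and carry the labels `ws`. -/
structure IsCut (G : SLHRGrammar rk) (h : HGraph (T ⊕ ℕ)) (ν : ℕ → ℕ) (l : List (ℕ × T))
    (ws : List (T ⊕ ℕ)) (vs : List ℕ) : Prop where
  ne_nil : ws ≠ []
  length_eq : ws.length = vs.length
  label : ∀ lab ∈ ws, G.RuleLabel h lab
  incident : ∀ x ∈ vs, ∃ e ∈ h.edges, x ∈ e.att
  sublist : (vs.map ν).Sublist (l.map Prod.fst)
  word : l.map Prod.snd = G.expand ws

/-- A walk in the hypergraph derived from `h` that starts in a node of `h` and ends in an external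
node of `h` is cut at the nodes of `h`; the pieces are read off as a string of labels. -/
theorem Embedded.exists_rule {G : SLHRGrammar rk} {h : HGraph (T ⊕ ℕ)} {ν : ℕ → ℕ} {n : ℕ}
    {I : ℕ → Prop} (H : G.Embedded h ν n I)
    (hlin : ∀ A ∈ G.N, Linear (G.valueEdges A) (G.ntRank A < ·)) {v z : ℕ} {l : List (ℕ × T)}
    (hv : v ∈ Finset.Icc 1 h.n) (hl : IWalk (G.yieldGraph h ν n) I (ν v) l z) (hz : ¬ I z) :
    ∃ ws vs, G.IsCut h ν l ws vs := by
  induction hk : l.length using Nat.strong_induction_on generalizing l v with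
  | _ k ih =>
    subst hk
    obtain ⟨a, t, ht, y, hy⟩ := hl.exists_cons
    obtain ⟨lab, l₁, v', hlab, hinc, hv', hw, hword⟩ := H.exists_piece hlin hv ⟨a, y, hy⟩
    obtain ⟨a₁, t₁, ht₁, -⟩ := hw.exists_cons
    rcases hw.eq_or_exists_append H.linear H.new hl hz with ⟨rfl, -⟩ | ⟨-, l₂, rfl, hl₂⟩
    · refine ⟨[lab], [v], by simp, rfl, by simpa using hlab, by simpa using hinc, ?_, hword⟩
      rw [ht₁]
      simp
    · obtain ⟨ws, vs, -, h2, h3, h4, h5, h6⟩ := ih l₂.length (by rw [ht₁]; simp) hv' hl₂ rfl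
      refine ⟨lab :: ws, v :: vs, by simp, by simp [h2], List.forall_mem_cons.2 ⟨hlab, h3⟩,
        List.forall_mem_cons.2 ⟨hinc, h4⟩, ?_, ?_⟩
      · rw [ht₁, List.map_cons, List.cons_append, List.map_cons]
        refine List.Sublist.cons_cons _ (h5.trans ?_)
        rw [List.map_append]
        exact List.sublist_append_right _ _
      · rw [List.map_append, hword, h6]
        simp [expand]

end SLHRGrammar

/-! ### Deriving string-graphs -/

namespace HGraph

variable {L T : Type*}

/-- The edges of a path through the given nodes, labelled by the given word. -/
def chain : List L → List ℕ → List (HEdge L)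
  | a :: w, u :: v :: l => ⟨a, [u, v]⟩ :: chain w (v :: l)
  | _, _ => []

theorem chain_map (ρ : ℕ → ℕ) (w : List L) (l : List ℕ) :
    (chain w l).map (HEdge.rename ρ) = chain w (l.map ρ) := by
  induction w generalizing l with
  | nil => simp [chain]
  | cons a w ih =>
    match l with
    | [] => rfl
    | [u] => rfl
    | u :: v :: l =>
      rw [chain, List.map_cons, ih]
      rfl

theorem chain_append (w₁ w₂ : List L) (u v : ℕ) (l₁ l₂ : List ℕ)
    (h : l₁.length + 1 = w₁.length) :
    chain (w₁ ++ w₂) (u :: l₁ ++ v :: l₂) = chain w₁ (u :: l₁ ++ [v]) ++ chain w₂ (v :: l₂) := by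
  induction l₁ generalizing u w₁ with
  | nil =>
    match w₁, h with
    | [a], _ => simp [chain]
  | cons x l₁ ih =>
    match w₁, h with
    | a :: w₁, h =>
      have := ih w₁ x (by simpa using h)
      simp only [List.cons_append, chain] at this ⊢
      rw [this]

theorem chain_range' (w : List L) (k : ℕ) :
    chain w (List.range' k (w.length + 1)) =
      List.ofFn fun i : Fin w.length => (⟨w.get i, [k + i, k + i + 1]⟩ : HEdge L) := by
  induction w generalizing k with
  | nil => simp [chain]
  | cons a w ih =>
    have := ih (k + 1)
    rw [List.range'_succ] at this
    refine Eq.trans ?_ (List.ofFn_succ ..).symm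
    change chain (a :: w) (List.range' k (w.length + 1 + 1)) = _
    rw [List.range'_succ, List.range'_succ, chain, this]
    simp [add_comm, add_left_comm]

theorem sGraph_edges (w : List L) :
    (sGraph w).edges = (chain w (List.range' 1 (w.length + 1)) : Multiset (HEdge L)) := by
  rw [chain_range', sGraph]
  simp only [add_comm 1]

/-- The pair (attachment, nonterminal) recorded for a nonterminal edge. -/
def ntOf (e : HEdge (T ⊕ ℕ)) : Option (List ℕ ×ₗ ℕ) :=
  match e.lab with
  | Sum.inl _ => none
  | Sum.inr A => some (toLex (e.att, A))

theorem siblings_eq_sort (h : HGraph (T ⊕ ℕ)) :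
    h.siblings = (h.edges.filterMap ntOf).sort (· ≤ ·) := rfl

/-- Along a path with increasing nodes, the order of siblings is the order along the path. -/
theorem pairwise_chain (ws : List (T ⊕ ℕ)) (k m : ℕ) :
    ((chain ws (List.range' k m)).filterMap ntOf).Pairwise (· ≤ ·) ∧
      ∀ c ∈ (chain ws (List.range' k m)).filterMap ntOf, ∃ i, k ≤ i ∧ (ofLex c).1 = [i, i + 1] := by
  induction ws generalizing k m with
  | nil => simp [chain]
  | cons a ws ih =>
    match m with
    | 0 => simp [chain]
    | 1 => simp [chain]
    | m + 2 =>
      obtain ⟨h1, h2⟩ := ih (k + 1) (m + 1)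
      rw [List.range'_succ] at h1 h2
      rw [List.range'_succ, List.range'_succ, chain]
      cases a with
      | inl a =>
        rw [List.filterMap_cons_none rfl]
        refine ⟨h1, fun c hc => ?_⟩
        obtain ⟨i, hi, hi'⟩ := h2 c hc
        exact ⟨i, by omega, hi'⟩
      | inr A =>
        rw [List.filterMap_cons_some (show ntOf (⟨Sum.inr A, [k, k + 1]⟩ : HEdge (T ⊕ ℕ)) =
          some (toLex ([k, k + 1], A)) from rfl)]
        refine ⟨List.pairwise_cons.2 ⟨fun c hc => ?_, h1⟩, fun c hc => ?_⟩
        · obtain ⟨i, hi, hi'⟩ := h2 c hc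
          rw [Prod.Lex.le_iff]
          left
          rw [hi']
          exact List.Lex.rel (by omega)
        · rcases List.mem_cons.1 hc with rfl | hc
          · exact ⟨k, le_rfl, rfl⟩
          · obtain ⟨i, hi, hi'⟩ := h2 c hc
            exact ⟨i, by omega, hi'⟩

theorem siblings_sGraph (ws : List (T ⊕ ℕ)) :
    (sGraph ws).siblings = (chain ws (List.range' 1 (ws.length + 1))).filterMap ntOf := by
  rw [siblings_eq_sort, sGraph_edges, Multiset.filterMap_coe]
  exact List.Perm.eq_of_pairwise (fun a b _ _ h1 h2 => le_antisymm h1 h2)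
    (Multiset.pairwise_sort ..) (pairwise_chain ..).1 (Multiset.coe_eq_coe.1 (Multiset.sort_eq ..))

theorem internal_sGraph (w : List L) : (sGraph w).internal = Finset.Icc 2 w.length := by
  ext v
  simp only [internal, sGraph, Finset.mem_filter, Finset.mem_Icc, List.mem_cons, List.not_mem_nil,
    or_false]
  omega

theorem map_nodeMap_sGraph {w : List L} (hw : w ≠ []) (n a b : ℕ) :
    (List.range' 1 (w.length + 1)).map ((sGraph w).nodeMap n [a, b]) =
      a :: (List.range' (n + 1) (w.length - 1) ++ [b]) := by
  have hpos := List.length_pos_of_ne_nil hw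
  refine List.ext_getElem (by simp; omega) fun i h1 h2 => ?_
  rw [List.getElem_map, List.getElem_range']
  simp only [List.length_map, List.length_range'] at h1
  rcases Nat.eq_zero_or_pos i with rfl | hi
  · simp [nodeMap, sGraph]
  · obtain ⟨i, rfl⟩ : ∃ j, i = j + 1 := ⟨i - 1, by omega⟩
    rw [List.getElem_cons_succ]
    rcases Nat.lt_or_ge i (w.length - 1) with hlt | hge
    · rw [List.getElem_append_left (by simpa using hlt), List.getElem_range', nodeMap,
        if_neg (by simp [sGraph]; omega), internal_sGraph]
      have : (Finset.Icc 2 w.length).filter (· ≤ 1 + 1 * (i + 1)) = Finset.Icc 2 (i + 2) := by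
        ext v
        simp only [Finset.mem_filter, Finset.mem_Icc]
        omega
      rw [this, Nat.card_Icc]
      omega
    · obtain rfl : i = w.length - 1 := by omega
      rw [List.getElem_append_right (by simp)]
      have h3 : 1 + 1 * (w.length - 1 + 1) = w.length + 1 := by omega
      have h4 : (sGraph w).nodeMap n [a, b] (w.length + 1) = b := by
        simp [nodeMap, sGraph, hw]
      rw [h3, h4]
      simp

end HGraph

namespace SLHRGrammar

open HGraph

variable {T : Type*} {rk : T → ℕ}

theorem yieldGraph_sGraph (G : SLHRGrammar rk) (ws : List (T ⊕ ℕ)) (ν : ℕ → ℕ) (n : ℕ) :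
    G.yieldGraph (sGraph ws) ν n =
      ((chain ws ((List.range' 1 (ws.length + 1)).map ν)).filter (fun e => e.lab.isLeft) :
        Multiset (HEdge (T ⊕ ℕ))) +
      G.yieldList ((chain ws ((List.range' 1 (ws.length + 1)).map ν)).filterMap ntOf) n := by
  rw [yieldGraph, termEdges, sGraph_edges, siblings_sGraph, ← chain_map]
  congr 1
  · rw [Multiset.filter_coe, Multiset.map_coe, List.filter_map]
    congr 2
    exact List.filter_congr fun e _ => by simp [HEdge.rename]
  · congr 1
    rw [List.map_filterMap, List.filterMap_map]
    congr 1
    funext e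
    obtain ⟨_ | _, _⟩ := e <;> rfl

/-- The number of new nodes when the nonterminal edges of a chain are derived. -/
theorem newCountList_siblings_sGraph (G : SLHRGrammar rk) (ws : List (T ⊕ ℕ)) (ν : ℕ → ℕ) :
    G.newCountList (sGraph ws).siblings =
      G.newCountList ((chain ws ((List.range' 1 (ws.length + 1)).map ν)).filterMap ntOf) := by
  rw [siblings_sGraph, ← chain_map, ← G.newCountList_map_mapAtt ν, List.map_filterMap,
    List.filterMap_map]
  congr 2
  funext e
  obtain ⟨_ | _, _⟩ := e <;> rfl

/-- Deriving an `x`-labelled edge from `a` to `b` gives a path from `a` to `b` with label `w`,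
through all the new nodes. -/
def YieldsPath (G : SLHRGrammar rk) (x : ℕ) (w : List T) : Prop :=
  ∀ a b n, ∃ mid : List ℕ, mid.Perm (List.range' (n + 1) (G.newCount x)) ∧
    mid.length + 1 = w.length ∧
    G.yield x [a, b] n = ((chain (w.map Sum.inl) (a :: mid ++ [b]) : List (HEdge (T ⊕ ℕ))) :
      Multiset (HEdge (T ⊕ ℕ)))

/-- If every nonterminal on a path yields a path, then deriving the whole path yields a path that
visits its old nodes and all the new nodes, each once. -/
theorem exists_chain (G : SLHRGrammar rk) {W : ℕ → List T} (ws : List (T ⊕ ℕ))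
    (hws : ∀ x, Sum.inr x ∈ ws → G.YieldsPath x (W x)) (u : ℕ) (us : List ℕ)
    (hlen : us.length = ws.length) (n : ℕ) :
    ∃ us' : List ℕ,
      us'.Perm (us ++ List.range' (n + 1)
        (G.newCountList ((chain ws (u :: us)).filterMap ntOf))) ∧
      us'.length = (ws.flatMap (Sum.elim (fun a => [a]) W)).length ∧
      (u :: us').getLast? = (u :: us).getLast? ∧
      ((chain ws (u :: us)).filter (fun e => e.lab.isLeft) : Multiset (HEdge (T ⊕ ℕ))) +
        G.yieldList ((chain ws (u :: us)).filterMap ntOf) n =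
        ((chain ((ws.flatMap (Sum.elim (fun a => [a]) W)).map Sum.inl) (u :: us') :
          List (HEdge (T ⊕ ℕ))) : Multiset (HEdge (T ⊕ ℕ))) := by
  induction ws generalizing u us n with
  | nil =>
    obtain rfl := List.length_eq_zero_iff.1 hlen
    exact ⟨[], by simp [chain, newCountList], by simp, rfl, by simp [chain, yieldList]⟩
  | cons lab ws ih =>
    obtain ⟨v, us, rfl⟩ := List.exists_cons_of_length_pos (l := us) (by rw [hlen]; simp)
    have hlen' : us.length = ws.length := by simpa using hlen
    have hws' : ∀ x, Sum.inr x ∈ ws → G.YieldsPath x (W x) := fun x hx =>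
      hws x (List.mem_cons_of_mem _ hx)
    cases lab with
    | inl a =>
      obtain ⟨us', h1, h2, h3, h4⟩ := ih hws' v us hlen' n
      refine ⟨v :: us', ?_, by simp [h2], ?_, ?_⟩
      · rw [chain, List.filterMap_cons_none rfl]
        exact h1.cons v
      · rw [List.getLast?_cons_cons, h3, List.getLast?_cons_cons]
      · rw [chain, List.filterMap_cons_none rfl, List.filter_cons_of_pos rfl, ← Multiset.cons_coe,
          Multiset.cons_add, h4]
        rfl
    | inr x =>
      obtain ⟨mid, m1, m2, m3⟩ := hws x (by simp) u v n
      obtain ⟨us', h1, h2, h3, h4⟩ := ih hws' v us hlen' (n + G.newCount x)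
      have hf : (chain (Sum.inr x :: ws) (u :: v :: us)).filterMap ntOf =
          toLex ([u, v], x) :: (chain ws (v :: us)).filterMap ntOf := by
        rw [chain, List.filterMap_cons_some (show ntOf (⟨Sum.inr x, [u, v]⟩ : HEdge (T ⊕ ℕ)) =
          some (toLex ([u, v], x)) from rfl)]
      refine ⟨mid ++ v :: us', ?_, ?_, ?_, ?_⟩
      · rw [hf, newCountList_cons]
        change (mid ++ v :: us').Perm (v :: us ++ List.range' (n + 1) (G.newCount x + _))
        rw [← List.range'_append_1, List.cons_append]
        refine List.perm_middle.trans (List.Perm.cons v ?_)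
        refine (m1.append h1).trans ?_
        rw [← List.append_assoc, ← List.append_assoc, add_right_comm]
        exact List.Perm.append_right _ List.perm_append_comm
      · simp only [List.length_append, List.length_cons, List.flatMap_cons, Sum.elim_inr, h2]
        omega
      · rw [← List.cons_append, List.getLast?_append, h3, List.getLast?_cons_cons,
          List.getLast?_eq_some_getLast (List.cons_ne_nil v us)]
        rfl
      · rw [hf, yieldList, chain, List.filter_cons_of_neg (by simp), List.flatMap_cons,
          List.map_append, ← List.cons_append, Sum.elim_inr,
          chain_append _ _ _ _ _ _ (by simpa using m2), ← Multiset.coe_add, ← h4, ← m3]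
        exact add_left_comm _ _ _

end SLHRGrammar

/-! ### Isomorphism and grammars of string rules -/

namespace HGraph

variable {L T : Type*}

theorem Iso.symm {g h : HGraph L} (hgh : g.Iso h)
    (he : ∀ e ∈ g.edges, ∀ v ∈ e.att, v ∈ Set.Icc 1 g.n) (hx : ∀ v ∈ g.ext, v ∈ Set.Icc 1 g.n) :
    h.Iso g := by
  obtain ⟨σ, hσ, h1, h2⟩ := hgh
  have hinv := hσ.invOn_invFunOn
  refine ⟨Function.invFunOn σ (Set.Icc 1 g.n), hσ.symm hinv.symm, ?_, ?_⟩
  · rw [← h1, Multiset.map_map]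
    refine (Multiset.map_congr rfl fun e hee => ?_).trans (Multiset.map_id _)
    obtain ⟨a, att⟩ := e
    simp only [Function.comp_apply, HEdge.rename, List.map_map, id_eq, HEdge.mk.injEq, true_and]
    exact (List.map_congr_left fun v hv => hinv.1 (he _ hee v hv)).trans (List.map_id _)
  · rw [← h2, List.map_map]
    exact (List.map_congr_left fun v hv => hinv.1 (hx v hv)).trans (List.map_id _)

theorem Iso.trans {g h k : HGraph L} (hgh : g.Iso h) (hhk : h.Iso k) : g.Iso k := by
  obtain ⟨σ, hσ, h1, h2⟩ := hgh
  obtain ⟨τ, hτ, h3, h4⟩ := hhk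
  refine ⟨τ ∘ σ, hτ.comp hσ, ?_, ?_⟩
  · rw [← h3, ← h1, Multiset.map_map]
    refine Multiset.map_congr rfl fun e _ => ?_
    simp [HEdge.rename]
  · rw [← h4, ← h2, List.map_map]

theorem Iso.refl (g : HGraph L) : g.Iso g := by
  refine ⟨id, Set.bijOn_id _, ?_, List.map_id _⟩
  refine (Multiset.map_congr rfl fun e _ => ?_).trans (Multiset.map_id _)
  simp [HEdge.rename]

theorem sGraph_valid {rk : L → ℕ} {w : List L} (hw : w ≠ []) (hrk : ∀ a ∈ w, rk a = 2) :
    (sGraph w).Valid rk := by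
  have hpos := List.length_pos_of_ne_nil hw
  refine ⟨by simp [sGraph], ?_, ?_, ?_, ?_, ?_, ?_⟩
  · intro e he v hv
    obtain ⟨i, hi, rfl⟩ := mem_sGraph_edges.1 he
    simp only [List.mem_cons, List.not_mem_nil, or_false] at hv
    simp only [sGraph, Finset.mem_Icc]
    omega
  · intro e he
    obtain ⟨i, hi, rfl⟩ := mem_sGraph_edges.1 he
    simp
  · intro e he
    obtain ⟨i, hi, rfl⟩ := mem_sGraph_edges.1 he
    exact (hrk _ (List.getElem_mem _)).symm
  · intro e he
    obtain ⟨i, hi, rfl⟩ := mem_sGraph_edges.1 he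
    simp
  · intro v hv
    simp only [sGraph, List.mem_cons, List.not_mem_nil, or_false] at hv
    simp only [sGraph, Finset.mem_Icc]
    omega
  · simp [sGraph, hw]

theorem sGraph_size (w : List L) : (sGraph w).size = 2 * w.length + 1 := by
  have h : ∀ e ∈ (sGraph w).edges, (if e.rank ≤ 2 then 1 else e.rank) = 1 := by
    intro e he
    obtain ⟨i, hi, rfl⟩ := mem_sGraph_edges.1 he
    rfl
  rw [size, edgeSize, Multiset.map_congr rfl h, Multiset.map_const', Multiset.sum_replicate]
  simp only [sGraph, Multiset.coe_card, List.length_ofFn, smul_eq_mul, mul_one]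
  omega

theorem exists_lab_sGraph {w : List L} {a : L} :
    (∃ e ∈ (sGraph w).edges, e.lab = a) ↔ a ∈ w := by
  constructor
  · rintro ⟨e, he, rfl⟩
    obtain ⟨i, hi, rfl⟩ := mem_sGraph_edges.1 he
    exact List.getElem_mem _
  · intro h
    obtain ⟨i, hi, rfl⟩ := List.getElem_of_mem h
    exact ⟨_, mem_sGraph_edges.2 ⟨i, hi, rfl⟩, rfl⟩

/-- A path through all the nodes, each visited once, is a string-graph. -/
theorem iso_sGraph_chain (w : List L) {l : List ℕ} {n : ℕ} (hlen : l.length = w.length + 1)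
    (hl : l.Perm (List.range' 1 n)) :
    (sGraph w).Iso ⟨n, (chain w l : List (HEdge L)), [l[0], l[w.length]]⟩ := by
  have hnd : l.Nodup := hl.nodup_iff.2 List.nodup_range'
  have hmap : (List.range' 1 (w.length + 1)).map (fun i => l.getD (i - 1) 0) = l := by
    refine List.ext_getElem (by simp [hlen]) fun i h1 h2 => ?_
    rw [List.getElem_map, List.getElem_range', List.getD_eq_getElem _ _ (by omega)]
    congr 1
    omega
  refine ⟨fun i => l.getD (i - 1) 0, ⟨?_, ?_, ?_⟩, ?_, ?_⟩
  · intro i hi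
    simp only [sGraph, Set.mem_Icc] at hi
    change l.getD (i - 1) 0 ∈ Set.Icc 1 n
    rw [List.getD_eq_getElem _ _ (by omega)]
    have := hl.mem_iff.1 (List.getElem_mem (by omega : i - 1 < l.length))
    rw [List.mem_range'_1] at this
    exact ⟨by omega, by omega⟩
  · intro i hi j hj hij
    simp only [sGraph, Set.mem_Icc] at hi hj
    simp only at hij
    rw [List.getD_eq_getElem _ _ (by omega), List.getD_eq_getElem _ _ (by omega),
      hnd.getElem_inj_iff] at hij
    omega
  · intro v hv
    have hv2 : v ≤ n := hv.2
    have hv' : v ∈ l := hl.mem_iff.2 (List.mem_range'_1.2 ⟨hv.1, by omega⟩)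
    obtain ⟨i, hi, rfl⟩ := List.getElem_of_mem hv'
    exact ⟨i + 1, ⟨by omega, by simp only [sGraph]; omega⟩, by simp [hi]⟩
  · rw [sGraph_edges, Multiset.map_coe, chain_map, hmap]
  · simp [sGraph, hlen]

end HGraph

namespace SLHRGrammar

open HGraph

variable {T : Type*} {rk : T → ℕ}

/-- All right-hand sides of `G` are string-graphs, and `W x` is the word generated by the
nonterminal `x`. -/
structure StringRules (G : SLHRGrammar rk) (ws : List (T ⊕ ℕ)) (rule : ℕ → List (T ⊕ ℕ))
    (W : ℕ → List T) : Prop where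
  start_eq : G.start = sGraph ws
  rhs_eq : ∀ x ∈ G.N, G.rhs x = sGraph (rule x)
  rule_ne_nil : ∀ x ∈ G.N, rule x ≠ []
  word_eq : ∀ x ∈ G.N, W x = (rule x).flatMap (Sum.elim (fun a => [a]) W)

namespace StringRules

variable {G : SLHRGrammar rk} {ws : List (T ⊕ ℕ)} {rule : ℕ → List (T ⊕ ℕ)} {W : ℕ → List T}

theorem yieldsPath (S : StringRules G ws rule W) {x : ℕ} (hx : x ∈ G.N) :
    G.YieldsPath x (W x) := by
  induction x using G.wellFounded_uses.induction with
  | _ x ih =>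
    intro a b n
    have hpos := List.length_pos_of_ne_nil (S.rule_ne_nil x hx)
    obtain ⟨us', h1, h2, h3, h4⟩ := G.exists_chain (W := W) (rule x) (fun y hy => by
      rw [← exists_lab_sGraph, ← S.rhs_eq x hx] at hy
      obtain ⟨e, he, hl⟩ := id hy
      exact ih y ⟨hx, hy⟩ (G.rhs_closed x hx e he y hl)) a
      (List.range' (n + 1) ((rule x).length - 1) ++ [b]) (by simp; omega)
      (n + ((rule x).length - 1))
    rw [← map_nodeMap_sGraph (S.rule_ne_nil x hx), ← yieldGraph_sGraph] at h4
    rw [← map_nodeMap_sGraph (S.rule_ne_nil x hx), ← newCountList_siblings_sGraph] at h1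
    have hint : (sGraph (rule x)).internal.card = (rule x).length - 1 := by
      rw [internal_sGraph, Nat.card_Icc]; omega
    rw [← S.word_eq x hx] at h2 h4
    rw [← hint] at h4
    rw [← S.rhs_eq x hx] at h1 h4
    rw [← G.yield_eq hx] at h4
    have hlast : (a :: us').getLast? = some b := by
      rw [h3, ← List.cons_append, List.getLast?_append]; rfl
    have hne : us' ≠ [] := by
      rintro rfl
      have := h1.length_eq
      simp at this
    obtain ⟨mid, z, rfl⟩ : ∃ mid z, us' = mid ++ [z] :=
      ⟨_, _, (List.dropLast_append_getLast hne).symm⟩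
    rw [← List.cons_append, List.getLast?_append] at hlast
    obtain rfl : z = b := by simpa using hlast
    refine ⟨mid, ?_, by simpa using h2, h4⟩
    have hcount : G.newCount x =
        ((rule x).length - 1) + G.newCountList (G.rhs x).siblings := by
      rw [G.newCount_eq hx, ← hint, ← S.rhs_eq x hx]
    rw [hcount, ← List.range'_append_1]
    refine (List.perm_append_right_iff [z]).1 (h1.trans ?_)
    rw [List.append_assoc, List.append_assoc, add_right_comm]
    exact List.Perm.append_left _ List.perm_append_comm

/-- A grammar all of whose right-hand sides are string-graphs generates the string-graph of the
word that it generates as a string grammar. -/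
theorem iso_val (S : StringRules G ws rule W) :
    (sGraph ((ws.flatMap (Sum.elim (fun a => [a]) W)).map Sum.inl)).Iso G.val := by
  have hid : (List.range' 1 (ws.length + 1)).map id = 1 :: List.range' 2 ws.length := by
    rw [List.map_id, List.range'_succ]
  obtain ⟨us', h1, h2, h3, h4⟩ := G.exists_chain (W := W) ws (fun y hy => by
      rw [← exists_lab_sGraph, ← S.start_eq] at hy
      obtain ⟨e, he, hl⟩ := hy
      exact S.yieldsPath (G.start_closed e he y hl)) 1 (List.range' 2 ws.length) (by simp)
      (ws.length + 1)
  rw [← hid, ← yieldGraph_sGraph, ← S.start_eq] at h4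
  rw [← hid, ← newCountList_siblings_sGraph, ← S.start_eq] at h1
  rw [G.val_eq]
  have hn : G.start.n = ws.length + 1 := by rw [S.start_eq]; rfl
  rw [hn, h4]
  have hperm : (1 :: us').Perm
      (List.range' 1 (ws.length + 1 + G.newCountList G.start.siblings)) := by
    rw [← List.range'_append_1, List.range'_succ]
    refine (h1.cons 1).trans ?_
    rw [List.cons_append, add_comm 1 (ws.length + 1)]
  have hlen : (1 :: us').length =
      ((ws.flatMap (Sum.elim (fun a => [a]) W)).map (Sum.inl (β := ℕ))).length + 1 := by
    simp [h2]
  have hiso := iso_sGraph_chain ((ws.flatMap (Sum.elim (fun a => [a]) W)).map (Sum.inl (β := ℕ)))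
    hlen hperm
  convert hiso using 2
  rw [S.start_eq]
  have hlast : (1 :: List.range' 2 ws.length).getLast? = some (ws.length + 1) := by
    rw [← hid, List.map_id, List.range'_concat, List.getLast?_append]
    simp [add_comm]
  rw [hlast, List.getLast?_eq_getElem?] at h3
  have h5 : (1 :: us').length - 1 =
      ((ws.flatMap (Sum.elim (fun a => [a]) W)).map (Sum.inl (β := ℕ))).length := by omega
  rw [h5, List.getElem?_eq_getElem (by omega), Option.some.injEq] at h3
  rw [h3]
  rfl

end StringRules

end SLHRGrammar

/-! ### The size bound and the string grammar -/

namespace HGraph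

variable {L T : Type*}

/-- The nodes incident with at least one edge. -/
def incident (h : HGraph L) : Finset ℕ :=
  (h.edges.bind fun e => (e.att : Multiset ℕ)).toFinset

theorem mem_incident {h : HGraph L} {v : ℕ} : v ∈ h.incident ↔ ∃ e ∈ h.edges, v ∈ e.att := by
  simp [incident]

theorem card_incident_le_n {rk : L → ℕ} {h : HGraph L} (hh : h.Valid rk) :
    h.incident.card ≤ h.n := by
  have hsub : h.incident ⊆ Finset.Icc 1 h.n := fun v hv => by
    obtain ⟨e, he, hv⟩ := mem_incident.1 hv
    exact hh.att_mem e he v hv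
  simpa using Finset.card_le_card hsub

theorem card_incident_le_edgeSize (h : HGraph L) : h.incident.card ≤ 2 * h.edgeSize := by
  refine (Multiset.toFinset_card_le _).trans ?_
  rw [Multiset.card_bind, edgeSize, ← Multiset.sum_map_mul_left]
  refine Multiset.sum_map_le_sum_map _ _ fun e _ => ?_
  change e.rank ≤ 2 * if e.rank ≤ 2 then 1 else e.rank
  split_ifs <;> omega

/-- The size of string-graphs whose edges start in different nodes of `h`, each incident with an
edge of `h`. -/
theorem sum_size_le {rk : L → ℕ} {h : HGraph L} (hh : h.Valid rk) (C : Finset ℕ)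
    (vs : ℕ → List ℕ) (hne : ∀ x ∈ C, vs x ≠ []) (hnd : ∀ x ∈ C, (vs x).Nodup)
    (hinc : ∀ x ∈ C, ∀ v ∈ vs x, ∃ e ∈ h.edges, v ∈ e.att)
    (hdisj : ∀ x ∈ C, ∀ y ∈ C, ∀ v, v ∈ vs x → v ∈ vs y → x = y) :
    ∑ x ∈ C, (2 * (vs x).length + 1) ≤ 2 * h.size := by
  have h1 : ∑ x ∈ C, (vs x).length ≤ h.incident.card := by
    rw [Finset.sum_congr rfl fun x hx => (List.toFinset_card_of_nodup (hnd x hx)).symm,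
      ← Finset.card_biUnion]
    · refine Finset.card_le_card fun v hv => ?_
      obtain ⟨x, hx, hv⟩ := Finset.mem_biUnion.1 hv
      exact mem_incident.2 (hinc x hx v (List.mem_toFinset.1 hv))
    · intro x hx y hy hxy
      refine Finset.disjoint_left.2 fun v hv hv' => hxy ?_
      exact hdisj x hx y hy v (List.mem_toFinset.1 hv) (List.mem_toFinset.1 hv')
  -- As `vs x` is nonempty, its string-graph has size at most `3 * (vs x).length`.
  have h2 : ∑ x ∈ C, (2 * (vs x).length + 1) ≤ ∑ x ∈ C, 3 * (vs x).length :=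
    Finset.sum_le_sum fun x hx => by
      have := List.length_pos_of_ne_nil (hne x hx)
      omega
  rw [← Finset.mul_sum] at h2
  have h3 := card_incident_le_n hh
  have h4 := h.card_incident_le_edgeSize
  rw [size]
  omega

end HGraph

namespace SLHRGrammar

open HGraph

variable {T : Type*} {rk : T → ℕ}

open Classical in
/-- An acyclic system of string rules, restricted to the nonterminals that are reachable from the
start string, is a grammar. -/
theorem exists_stringGrammar (rk : T → ℕ) (C : Finset ℕ) (ws : List (T ⊕ ℕ))
    (rule : ℕ → List (T ⊕ ℕ)) (hws : ws ≠ []) (hrule : ∀ x ∈ C, rule x ≠ [])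
    (hwsT : ∀ a, Sum.inl a ∈ ws → rk a = 2) (hwsN : ∀ x, Sum.inr x ∈ ws → x ∈ C)
    (hruleT : ∀ x ∈ C, ∀ a, Sum.inl a ∈ rule x → rk a = 2)
    (hruleN : ∀ x ∈ C, ∀ y, Sum.inr y ∈ rule x → y ∈ C)
    (hacyc : ∀ x, ¬ Relation.TransGen (fun x y => x ∈ C ∧ Sum.inr y ∈ rule x) x x) :
    ∃ G : SLHRGrammar rk, G.N ⊆ C ∧ G.start = sGraph ws ∧ ∀ x, G.rhs x = sGraph (rule x) := by
  let R : ℕ → ℕ → Prop := fun x y => x ∈ C ∧ Sum.inr y ∈ rule x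
  let N : Finset ℕ := C.filter fun x => ∃ B, Sum.inr B ∈ ws ∧ Relation.ReflTransGen R B x
  have hlab : ∀ l : List (T ⊕ ℕ), (∀ a, Sum.inl a ∈ l → rk a = 2) →
      ∀ s ∈ l, Sum.elim rk (fun _ => 2) s = 2 := by
    rintro l hl (a | x) hs
    · exact hl a hs
    · rfl
  have hclosed : ∀ x ∈ N, ∀ y, Sum.inr y ∈ rule x → y ∈ N := by
    intro x hx y hy
    obtain ⟨hxC, B, hB, hBx⟩ := Finset.mem_filter.1 hx
    exact Finset.mem_filter.2 ⟨hruleN x hxC y hy, B, hB, hBx.tail ⟨hxC, hy⟩⟩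
  have hstart : ∀ y, Sum.inr y ∈ ws → y ∈ N := fun y hy =>
    Finset.mem_filter.2 ⟨hwsN y hy, y, hy, .refl⟩
  refine ⟨{ N := N, ntRank := fun _ => 2, rhs := fun x => sGraph (rule x), start := sGraph ws,
            rhs_valid := fun x hx => ?_, start_valid := sGraph_valid hws (hlab _ hwsT),
            rhs_rank := fun x _ => rfl, rhs_closed := fun x hx e he y hy => ?_,
            start_closed := fun e he y hy => ?_, acyclic := fun x hx => ?_,
            reachable := fun x hx => ?_ }, Finset.filter_subset _ _, rfl, fun _ => rfl⟩
  · have hxC := (Finset.mem_filter.1 hx).1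
    exact sGraph_valid (hrule x hxC) (hlab _ (hruleT x hxC))
  · exact hclosed x hx y (exists_lab_sGraph.1 ⟨e, he, hy⟩)
  · exact hstart y (exists_lab_sGraph.1 ⟨e, he, hy⟩)
  · exact hacyc x (Relation.TransGen.mono
      (fun y z h => ⟨(Finset.mem_filter.1 h.1).1, exists_lab_sGraph.1 h.2⟩) _ _ hx)
  · obtain ⟨-, B, hB, hBx⟩ := Finset.mem_filter.1 hx
    obtain ⟨e, he, hl⟩ := exists_lab_sGraph.2 hB
    refine ⟨e, he, B, hl, ?_⟩
    clear hx
    induction hBx with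
    | refl => exact .refl
    | @tail y z hBy h ih =>
      exact ih.tail ⟨Finset.mem_filter.2 ⟨h.1, B, hB, hBy⟩, exists_lab_sGraph.2 h.2⟩

open Classical in
/-- The segments of the nonterminals of `G`. -/
noncomputable def segments (G : SLHRGrammar rk) : Finset ℕ :=
  (G.N.biUnion fun A => (Finset.Icc 1 (G.ntRank A)).image (Nat.pair A)).filter G.IsSegment

theorem mem_segments {G : SLHRGrammar rk} {x : ℕ} : x ∈ G.segments ↔ G.IsSegment x := by
  classical
  rw [segments, Finset.mem_filter, and_iff_right_iff_imp]
  intro h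
  refine Finset.mem_biUnion.2 ⟨_, h.1, Finset.mem_image.2 ⟨x.unpair.2, ?_, Nat.pair_unpair x⟩⟩
  exact Finset.mem_Icc.2 ⟨h.2.1, h.2.2.1⟩

/-- The embedding of the right-hand side of `A` in the hypergraph derived from `A`. -/
noncomputable def rhsEmbed (G : SLHRGrammar rk) (A : ℕ) : ℕ → ℕ :=
  (G.rhs A).nodeMap (G.ntRank A) (List.range' 1 (G.ntRank A))

/-- Every segment has a rule over the segments of the nonterminals in the right-hand side that it
comes from; the edges of the new rule start in nodes of that right-hand side. -/
theorem exists_segment_rule (G : SLHRGrammar rk)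
    (hlin : ∀ A ∈ G.N, Linear (G.valueEdges A) (G.ntRank A < ·)) {x : ℕ} (hx : G.IsSegment x) :
    ∃ ws vs, G.IsCut (G.rhs x.unpair.1) (G.rhsEmbed x.unpair.1) (G.segment x) ws vs := by
  have hN := hx.1
  have hr := G.rhs_rank _ hN
  obtain ⟨z, hz, -, hz2⟩ := hx.walk (hlin _ hN)
  have H := G.embedded_rhs hN (hlin _ hN)
  have hlt : x.unpair.2 - 1 < (G.rhs x.unpair.1).ext.length := by
    have := hx.2.1
    have := hx.2.2.1
    rw [HGraph.rank] at hr
    omega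
  have hmem := List.getElem_mem hlt
  have hval := G.rhs_valid _ hN
  have hν : G.rhsEmbed x.unpair.1 ((G.rhs x.unpair.1).ext[x.unpair.2 - 1]) = x.unpair.2 := by
    obtain ⟨hi, h⟩ := nodeMap_of_mem_ext (att := List.range' 1 (G.ntRank x.unpair.1))
      (G.ntRank x.unpair.1) hmem (by rw [List.length_range', hr])
    rw [rhsEmbed, h, List.getElem_range', hval.ext_nodup.idxOf_getElem]
    have := hx.2.1
    omega
  rw [← hν, valueEdges, G.yield_eq hN] at hz
  exact H.exists_rule hlin (hval.ext_mem _ hmem) hz (not_lt.2 hz2)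

end SLHRGrammar

open HGraph SLHRGrammar in
theorem mainTheorem2 {T : Type*} (rk : T → ℕ) (G : SLHRGrammar rk)
    (hG : G.StringGenerating) :
    ∃ G' : SLHRGrammar rk,
      G'.val.Iso G.val ∧
      G'.size ≤ 2 * G.size ∧
      G'.start.IsStringGraph ∧
      ∀ A ∈ G'.N, (G'.rhs A).IsStringGraph := by
  classical
  obtain ⟨w, hw, hiso⟩ := hG
  obtain ⟨σ, hσ, hσe, hσx⟩ := id hiso
  have hle : G.start.n ≤ G.val.n := by rw [G.val_eq]; exact Nat.le_add_right _ _
  have hvale : G.val.edges = G.yieldGraph G.start id G.start.n := by rw [G.val_eq]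
  have hvalx : G.val.ext = G.start.ext := by rw [G.val_eq]
  have hadm := G.admissible_start
  have hext : ∀ v ∈ G.start.ext, 1 ≤ v ∧ v ≤ G.start.n := fun v hv =>
    Finset.mem_Icc.1 (hadm.valid.ext_mem v hv)
  have S : StringIso G.val w σ := by
    refine ⟨fun e he => ?_, fun v hv => ?_, hσ, hσe, hσx⟩
    · rw [hvale] at he
      obtain ⟨h1, h2⟩ := hadm.termOn id _ e he
      refine ⟨h1, fun v hv => ?_⟩
      rw [G.val_eq]
      rcases h2 v hv with ⟨u, hu, rfl⟩ | h
      · rw [Finset.mem_Icc] at hu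
        exact ⟨hu.1, hu.2.trans (Nat.le_add_right _ _)⟩
      · exact ⟨by omega, h.2⟩
    · rw [hvalx] at hv
      exact ⟨(hext v hv).1, (hext v hv).2.trans hle⟩
  have H : G.Embedded G.start id G.start.n (· ∉ G.start.ext) := by
    refine ⟨hadm, Set.injOn_id _, fun v hv => (Finset.mem_Icc.1 hv).2,
      fun v hv hv' => by have := hext v hv'; omega, fun v _ => Iff.rfl, ?_⟩
    rw [← hvale, ← hvalx]
    exact S.linear
  have hlin := fun A (hA : A ∈ G.N) => G.linear_of_embedded_start H hA
  -- The start string is cut from the walk that spells out the whole generated string.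
  obtain ⟨u, l, z, hu, hz, hl, hword⟩ := S.exists_walk hw
  rw [hvalx] at hu hz
  rw [hvale, hvalx] at hl
  obtain ⟨ws, vs, h1, h2, h3, h4, h5, h6⟩ := H.exists_rule hlin (v := u)
    (hadm.valid.ext_mem u hu) hl (not_not.2 hz)
  have hrules : ∀ x, ∃ (ws : List (T ⊕ ℕ)) (vs : List ℕ), G.IsSegment x →
      G.IsCut (G.rhs x.unpair.1) (G.rhsEmbed x.unpair.1) (G.segment x) ws vs := by
    intro x
    by_cases hx : G.IsSegment x
    · obtain ⟨ws, vs, h⟩ := G.exists_segment_rule hlin hx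
      exact ⟨ws, vs, fun _ => h⟩
    · exact ⟨[], [], fun h => absurd h hx⟩
  choose rule src hrule using hrules
  obtain ⟨G', hN, hstart, hrhs⟩ := exists_stringGrammar rk G.segments ws rule h1
    (fun x hx => (hrule x (mem_segments.1 hx)).ne_nil) (fun a ha => h3 _ ha)
    (fun x hx => mem_segments.2 (h3 _ hx).1)
    (fun x hx a ha => (hrule x (mem_segments.1 hx)).label _ ha)
    (fun x hx y hy => mem_segments.2 ((hrule x (mem_segments.1 hx)).label _ hy).1)
    (fun x hx => G.acyclic x.unpair.1 (Relation.TransGen.lift (fun x => x.unpair.1)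
      (fun x y hxy => by
        have hxs := mem_segments.1 hxy.1
        exact ⟨hxs.1, ((hrule x hxs).label _ hxy.2).2⟩) _ _ hx))
  have hseg : ∀ x ∈ G'.N, G.IsSegment x := fun x hx => mem_segments.1 (hN hx)
  refine ⟨G', ?_, ?_, ?_, fun x hx => ?_⟩
  · have hS : StringRules G' ws rule G.segmentWord :=
      ⟨hstart, fun x _ => hrhs x, fun x hx => (hrule x (hseg x hx)).ne_nil,
        fun x hx => (hrule x (hseg x hx)).word⟩
    have hw' : (ws.flatMap (Sum.elim (fun a => [a]) G.segmentWord)).map Sum.inl = w := by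
      rw [← hword, ← expand, ← h6, List.map_map]
      rfl
    have hiso' := hS.iso_val
    rw [hw'] at hiso'
    have hval := sGraph_valid (rk := fun _ : T ⊕ ℕ => 2) hw fun _ _ => rfl
    have hsymm := hiso'.symm (fun e he v hv => Finset.mem_Icc.1 (hval.att_mem e he v hv))
      (fun v hv => Finset.mem_Icc.1 (hval.ext_mem v hv))
    exact hsymm.trans (hiso.symm (fun e he => (S.edges e he).2) S.ext)
  · have hs : G'.start.size ≤ 2 * G.start.size := by
      rw [hstart, sGraph_size, h2]
      have := sum_size_le hadm.valid {0} (fun _ => vs)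
        (fun _ _ => by rintro rfl; exact h1 (List.length_eq_zero_iff.1 h2))
        (fun _ _ => (h5.nodup (hl.nodup H.linear)).of_map) (fun _ _ => h4)
        (fun x hx y hy _ _ _ => by rw [Finset.mem_singleton.1 hx, Finset.mem_singleton.1 hy])
      simpa using this
    have hA : ∀ A ∈ G.N, ∑ x ∈ G.segments with x.unpair.1 = A, (G'.rhs x).size ≤
        2 * (G.rhs A).size := by
      intro A hA
      have hmem : ∀ x ∈ G.segments.filter (fun x => x.unpair.1 = A),
          G.IsSegment x ∧ x.unpair.1 = A := fun x hx =>
        ⟨mem_segments.1 (Finset.mem_filter.1 hx).1, (Finset.mem_filter.1 hx).2⟩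
      have hsrc : ∀ x ∈ G.segments.filter (fun x => x.unpair.1 = A),
          (G'.rhs x).size = 2 * (src x).length + 1 := fun x hx => by
        rw [hrhs, sGraph_size, (hrule x (hmem x hx).1).length_eq]
      rw [Finset.sum_congr rfl hsrc]
      refine sum_size_le (G.rhs_valid A hA) _ src (fun x hx => ?_) (fun x hx => ?_)
        (fun x hx => ?_) (fun x hx y hy v hvx hvy => ?_)
      · have := hrule x (hmem x hx).1
        intro h0
        exact this.ne_nil (List.length_eq_zero_iff.1 (by rw [this.length_eq, h0]; rfl))
      · obtain ⟨hxs, rfl⟩ := hmem x hx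
        obtain ⟨z, hz, -⟩ := hxs.walk (hlin _ hxs.1)
        exact ((hrule x hxs).sublist.nodup (hz.nodup (hlin _ hxs.1))).of_map
      · obtain ⟨hxs, rfl⟩ := hmem x hx
        exact (hrule x hxs).incident
      · obtain ⟨hxs, rfl⟩ := hmem x hx
        obtain ⟨hys, hyx⟩ := hmem y hy
        obtain ⟨z, hz, -⟩ := hxs.walk (hlin _ hxs.1)
        obtain ⟨z', hz', -⟩ := hys.walk (hlin _ hys.1)
        have hvx' := (hrule x hxs).sublist.subset (List.mem_map_of_mem hvx)
        have hvy' := (hrule y hys).sublist.subset (List.mem_map_of_mem hvy)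
        have hy2 := hys.2.2.1
        -- Two segments of the same nonterminal with a common source start in the same node.
        rw [hyx] at hz' hvy' hy2
        have h12 := hz.start_unique (hlin _ hxs.1) hz' (not_lt.2 hxs.2.2.1) (not_lt.2 hy2)
          hvx' hvy'
        rw [← Nat.pair_unpair x, ← Nat.pair_unpair y, hyx, h12]
    rw [SLHRGrammar.size, SLHRGrammar.size, mul_add, Finset.mul_sum]
    refine Nat.add_le_add hs ?_
    calc ∑ x ∈ G'.N, (G'.rhs x).size ≤ ∑ x ∈ G.segments, (G'.rhs x).size :=
          Finset.sum_le_sum_of_subset hN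
      _ = ∑ A ∈ G.N, ∑ x ∈ G.segments with x.unpair.1 = A, (G'.rhs x).size :=
          (Finset.sum_fiberwise_of_maps_to (fun x hx => (mem_segments.1 hx).1) _).symm
      _ ≤ ∑ A ∈ G.N, 2 * (G.rhs A).size := Finset.sum_le_sum hA
  · rw [hstart]
    exact ⟨ws, h1, Iso.refl _⟩
  · rw [hrhs]
    exact ⟨rule x, (hrule x (hseg x hx)).ne_nil, Iso.refl _⟩
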